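/- **Conventions.** $\mathbb{N}=\{0,1,2,\dots\}$. Let $\mathcal{LC}$ be the set of sequences $M\in\mathbb{R}_{>0}^{\mathbb{N}}$ with $1=M_0\le M_1$, $M_j^2\le M_{j-1}M_{j+1}$ for $j\ge1$, and $\lim_{j\to\infty}(M_j)^{1/j}=\infty$. A weight matrix is a family $\mathcal{M}=\{M^{(\alpha)}\in\mathbb{R}_{>0}^{\mathbb{N}}:\alpha>0\}$ with $M^{(\alpha)}_j\le M^{(\beta)}_j$ for all $j$ whenever $\alpha\le\beta$; it is standard log-convex if every $M^{(\alpha)}\in\mathcal{LC}$. Write $M\preceq N$ if $\sup_{j\ge1}(M_j/N_j)^{1/j}<\infty$. Matrices $\mathcal{M},\mathcal{N}$ are $R$-equivalent if for every $\alpha$ there is $\beta$ with $M^{(\alpha)}\preceq N^{(\beta)}$, and for every $\alpha$ there is $\beta$ with $N^{(\alpha)}\preceq M^{(\beta)}$; they are $B$-equivalent if for every $\alpha$ there is $\beta$ with $M^{(\beta)}\preceq N^{(\alpha)}$, and for every $\alpha$ there is $\beta$ with $N^{(\beta)}\preceq M^{(\alpha)}$. Consider the conditions * $(\mathcal{M}_{\{L\}})$: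 $\forall C>0\ \forall\alpha\ \exists D>0\ \exists\beta\ \forall j:\ C^jM^{(\alpha)}_j\le D M^{(\beta)}_j$; * $(\mathcal{M}_{(L)})$: $\forall C>0\ \forall\alpha\ \exists D>0\ \exists\beta\ \forall j:\ C^jM^{(\beta)}_j\le D M^{(\alpha)}_j$; * $(\mathcal{M}_{\{mg\}})$: $\forall\alpha\ \exists C>0\ \exists\beta\ \forall j,k:\ M^{(\alpha)}_{j+k}\le C^{j+k+1}M^{(\beta)}_jM^{(\beta)}_k$; * $(\mathcal{M}_{(mg)})$: $\forall\alpha\ \exists C>0\ \exists\beta\ \forall j,k:\ M^{(\beta)}_{j+k}\le C^{j+k+1}M^{(\alpha)}_jM^{(\alpha)}_k$. A (BMT) weight function is a continuous nondecreasing $\omega:[0,\infty)\to[0,\infty)$ with $\omega(0)=0$, $\log t=o(\omega(t))$ and $\omega(2t)=O(\omega(t))$ as $t\to\infty$, and $\varphi_\omega(t):=\omega(e^t)$ convex on $\mathbb{R}$; put $\varphi_\omega^*(x)=\sup_{y\ge0}(xy-\varphi_\omega(y))$. For $v\in\mathbb{R}_{>0}^{\mathbb{N}}$ and a compact $K\subset\mathbb{R}^d$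 with $K=\overline{K^\circ}$ (a regular compact set), let $\mathcal{E}(K)$ be the space of complex-valued $C^\infty$ functions on $K^\circ$ all of whose partial derivatives extend continuously to $K$, and let $\mathcal{E}_v(K)$ be the space of $f\in\mathcal{E}(K)$ with $\|f\|_{v,K}:=\sup_{\alpha\in\mathbb{N}^d,\,x\in K}|f^{(\alpha)}(x)|/v_{|\alpha|}<\infty$, normed by $\|\cdot\|_{v,K}$. For a weight matrix $\mathcal{M}$ use the weights $v^{x,h}_j=h^jM^{(x)}_j$ ($x,h>0$), and for a weight function $\omega$ the weights $v^h_j=\exp(\tfrac1h\varphi^*_\omega(hj))$ ($h>0$). For open $U\subseteq\mathbb{R}^d$, the Roumieu class $\mathcal{E}_{\{\cdot\}}(U)$ (resp. the Beurling class $\mathcal{E}_{(\cdot)}(U)$) consists of the smooth $f:U\to\mathbb{C}$ such that for every compact $K\subseteq U$ one has $\|f\|_{v,K}<\infty$ for some (resp. every) weight $v$ of the family. They carry the locally convex topologies $\mathcal{E}_{\{\cdot\}}(U)=\varprojlim_{K}\varinjlim_v\mathcal{E}_v(K)$ and $\mathcal{E}_{(\cdot)}(U)=\varprojlim_{K}\varprojlim_v\mathcal{E}_v(K)$,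 where $K$ runs over the regular compact subsets of $U$ and $\varinjlim$ is the locally convex inductive limit. **Statement.** Let $\mathcal{M}$ be a standard log-convex weight matrix. *Roumieu case.* The following are equivalent: 1. there is a weight function $\omega$ such that $\mathcal{E}_{\{\mathcal{M}\}}(U)=\mathcal{E}_{\{\omega\}}(U)$ as locally convex vector spaces for all $d\ge1$ and all non-empty open $U\subseteq\mathbb{R}^d$; 2. there is a standard log-convex weight matrix $\mathcal{N}=\{N^{(\alpha)}:\alpha>0\}$ which is $R$-equivalent to $\mathcal{M}$, has $(\mathcal{M}_{\{L\}})$ and $(\mathcal{M}_{\{mg\}})$, and satisfies $$\forall\alpha,\beta>0\ \exists c\in\mathbb{N}_{>0}\ \exists A\ge1\ \forall j\in\mathbb{N}:\quad N^{(\alpha)}_j\le A\,\bigl(N^{(\beta)}_{cj}\bigr)^{1/c}.$$ Moreover, for each fixed $d\ge1$ and non-empty open $U\subseteq\mathbb{R}^d$, condition 2 is equivalent to the existence of a weight function $\omega$ with $\mathcal{E}_{\{\mathcal{M}\}}(U)=\mathcal{E}_{\{\omega\}}(U)$ as locally convex vector spaces. *Beurling case.* The same holds with $\mathcal{E}_{(\cdot)}$,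 $B$-equivalence, $(\mathcal{M}_{(L)})$ and $(\mathcal{M}_{(mg)})$ in place of $\mathcal{E}_{\{\cdot\}}$, $R$-equivalence, $(\mathcal{M}_{\{L\}})$ and $(\mathcal{M}_{\{mg\}})$. -/

import Mathlib

open Set Filter Topology
open scoped ENNReal

/-! ### Weight sequences and weight matrices -/

/-- The index set `𝓘 = ℝ_{>0}` of weight matrices, with its natural order. -/
abbrev PosReal : Type := Set.Ioi (0 : ℝ)

/-- The class `𝓛𝓒`: positive sequences that are normalized (`1 = M₀ ≤ M₁`), log-convex and satisfy
`(M_j)^{1/j} → ∞`. -/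
structure IsLC (M : ℕ → ℝ) : Prop where
  pos : ∀ j, 0 < M j
  zero : M 0 = 1
  one : 1 ≤ M 1
  logConvex : ∀ j, M (j + 1) ^ 2 ≤ M j * M (j + 2)
  tendsto : Tendsto (fun j : ℕ => M j ^ (1 / (j : ℝ))) atTop atTop

/-- `M ≼ N`, i.e. `sup_{j ≥ 1} (M_j / N_j)^{1/j} < ∞`. -/
def SeqLE (M N : ℕ → ℝ) : Prop :=
  BddAbove {r : ℝ | ∃ j : ℕ, 1 ≤ j ∧ r = (M j / N j) ^ (1 / (j : ℝ))}

/-- A weight matrix: a family of positive sequences indexed by `ℝ_{>0}` which is pointwise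
nondecreasing in the index. -/
structure WeightMatrix where
  seq : PosReal → ℕ → ℝ
  pos : ∀ α j, 0 < seq α j
  mono : ∀ α β : PosReal, α ≤ β → ∀ j, seq α j ≤ seq β j

namespace WeightMatrix

/-- Standard log-convex matrices. -/
def IsStandardLogConvex (M : WeightMatrix) : Prop := ∀ α, IsLC (M.seq α)

/-- `M {≼} N`. -/
def RLE (M N : WeightMatrix) : Prop := ∀ α, ∃ β, SeqLE (M.seq α) (N.seq β)

/-- `M (≼) N`. -/
def BLE (M N : WeightMatrix) : Prop := ∀ α, ∃ β, SeqLE (M.seq β) (N.seq α)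

/-- R-equivalence. -/
def REquiv (M N : WeightMatrix) : Prop := M.RLE N ∧ N.RLE M

/-- B-equivalence. -/
def BEquiv (M N : WeightMatrix) : Prop := M.BLE N ∧ N.BLE M

/-- The Roumieu condition `(M_{L})`. -/
def CondRL (M : WeightMatrix) : Prop :=
  ∀ C : ℝ, 0 < C → ∀ α, ∃ D : ℝ, 0 < D ∧ ∃ β, ∀ j, C ^ j * M.seq α j ≤ D * M.seq β j

/-- The Beurling condition `(M_(L))`. -/
def CondBL (M : WeightMatrix) : Prop :=
  ∀ C : ℝ, 0 < C → ∀ α, ∃ D : ℝ, 0 < D ∧ ∃ β, ∀ j, C ^ j * M.seq β j ≤ D * M.seq α j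

/-- The Roumieu moderate growth condition `(M_{mg})`. -/
def CondRmg (M : WeightMatrix) : Prop :=
  ∀ α, ∃ C : ℝ, 0 < C ∧ ∃ β, ∀ j k,
    M.seq α (j + k) ≤ C ^ (j + k + 1) * M.seq β j * M.seq β k

/-- The Beurling moderate growth condition `(M_(mg))`. -/
def CondBmg (M : WeightMatrix) : Prop :=
  ∀ α, ∃ C : ℝ, 0 < C ∧ ∃ β, ∀ j k,
    M.seq β (j + k) ≤ C ^ (j + k + 1) * M.seq α j * M.seq α k

/-- For all `α, β` there are `c ∈ ℕ_{>0}` and `A ≥ 1` with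
`N^{(α)}_j ≤ A (N^{(β)}_{cj})^{1/c}` for all `j`. -/
def CondPowers (N : WeightMatrix) : Prop :=
  ∀ α β, ∃ c : ℕ, 0 < c ∧ ∃ A : ℝ, 1 ≤ A ∧
    ∀ j, N.seq α j ≤ A * N.seq β (c * j) ^ (1 / (c : ℝ))

end WeightMatrix

/-! ### Weight functions -/

/-- Weight functions `ω : [0,∞) → [0,∞)` in the sense of Braun, Meise and Taylor. Only the values
of `toFun` on `[0,∞)` matter. -/
structure WeightFunction where
  toFun : ℝ → ℝ
  nonneg : ∀ t, 0 ≤ t → 0 ≤ toFun t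
  continuousOn : ContinuousOn toFun (Set.Ici 0)
  monotoneOn : MonotoneOn toFun (Set.Ici 0)
  map_zero : toFun 0 = 0
  log_isLittleO : Real.log =o[atTop] toFun
  convexOn : ConvexOn ℝ Set.univ (fun t : ℝ => toFun (Real.exp t))
  doubling : (fun t : ℝ => toFun (2 * t)) =O[atTop] toFun

namespace WeightFunction

/-- The Young conjugate `φ*_ω(x) = sup_{y ≥ 0} (x y - φ_ω(y))` of `φ_ω(y) = ω(e^y)`. -/
noncomputable def youngConj (ω : WeightFunction) (x : ℝ) : ℝ :=
  ⨆ y : Set.Ici (0 : ℝ), (x * (y : ℝ) - ω.toFun (Real.exp (y : ℝ)))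

/-- The supremum defining the Young conjugate is finite. -/
theorem bddAbove_youngConj (ω : WeightFunction) (x : ℝ) :
    BddAbove (Set.range fun y : Set.Ici (0 : ℝ) =>
      x * (y : ℝ) - ω.toFun (Real.exp (y : ℝ))) := by
  have h1 := ω.log_isLittleO.def (c := 1 / (|x| + 1)) (by positivity)
  obtain ⟨T, hT⟩ := eventually_atTop.1 h1
  refine ⟨|x| * |T|, ?_⟩
  rintro _ ⟨⟨y, hy⟩, rfl⟩
  have hy0 : (0 : ℝ) ≤ y := hy
  have hw := ω.nonneg (Real.exp y) (Real.exp_pos y).le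
  have hxy : x * y ≤ |x| * y := mul_le_mul_of_nonneg_right (le_abs_self x) hy0
  by_cases hyT : y ≤ |T|
  · have : |x| * y ≤ |x| * |T| := mul_le_mul_of_nonneg_left hyT (abs_nonneg x)
    simp only
    linarith
  · have hyT' : T ≤ Real.exp y := by
      have := Real.add_one_le_exp y
      have := le_abs_self T
      linarith [not_le.1 hyT]
    have h2 := hT _ hyT'
    rw [Real.log_exp, Real.norm_eq_abs, Real.norm_eq_abs, abs_of_nonneg hy0, abs_of_nonneg hw,
      div_mul_eq_mul_div, one_mul, le_div_iff₀ (by positivity)] at h2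
    have : 0 ≤ |x| * |T| := by positivity
    simp only
    nlinarith

/-- The weights `exp ((1/h) φ*_ω(h j))`, `h > 0`. -/
noncomputable def weights (ω : WeightFunction) (h : PosReal) (j : ℕ) : ℝ :=
  Real.exp (1 / (h : ℝ) * ω.youngConj ((h : ℝ) * j))

theorem weights_mono (ω : WeightFunction) : Monotone ω.weights := by
  rintro ⟨h, hh⟩ ⟨k, hk⟩ hhk j
  have hh0 : (0 : ℝ) < h := hh
  have hk0 : (0 : ℝ) < k := hk
  have hle : h ≤ k := hhk
  refine Real.exp_le_exp.2 ?_
  simp only [youngConj]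
  rw [one_div_mul_eq_div, div_le_iff₀ hh0]
  refine ciSup_le fun y => ?_
  have hy := le_ciSup (ω.bddAbove_youngConj (k * j)) y
  have hw := ω.nonneg (Real.exp y) (Real.exp_pos _).le
  set s := ⨆ y : Set.Ici (0 : ℝ), (k * j * (y : ℝ) - ω.toFun (Real.exp (y : ℝ)))
  have e : 1 / k * s * h = s * h / k := by ring
  rw [e, le_div_iff₀ hk0]
  have h3 : (k * j * (y : ℝ) - ω.toFun (Real.exp (y : ℝ))) * h ≤ s * h :=
    mul_le_mul_of_nonneg_right hy hh0.le
  nlinarith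

theorem weights_directed (ω : WeightFunction) : Directed (· ≤ ·) ω.weights :=
  ω.weights_mono.directed_le

end WeightFunction

namespace WeightMatrix

/-- The weights `h^j M^{(x)}_j`, `x > 0`, `h > 0`. -/
def weights (M : WeightMatrix) (p : PosReal × PosReal) (j : ℕ) : ℝ :=
  (p.2 : ℝ) ^ j * M.seq p.1 j

theorem weights_mono (M : WeightMatrix) : Monotone M.weights := by
  rintro ⟨x, h⟩ ⟨y, k⟩ ⟨hxy, hhk⟩ j
  have hh0 : (0 : ℝ) < h := h.2
  have hk0 : (0 : ℝ) < k := k.2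
  exact mul_le_mul (pow_le_pow_left₀ hh0.le hhk j) (M.mono x y hxy j) (M.pos _ _).le
    (pow_nonneg hk0.le j)

theorem weights_directed (M : WeightMatrix) : Directed (· ≤ ·) M.weights :=
  M.weights_mono.directed_le

end WeightMatrix

/-! ### Smooth functions and their partial derivatives -/

/-- `ℝ^d`. -/
abbrev Eucl (d : ℕ) : Type := EuclideanSpace ℝ (Fin d)

section Ultra

variable {d : ℕ}

/-- The word in which every letter `i` occurs `α i` times. -/
def multiWord (α : Fin d → ℕ) : List (Fin d) :=
  (List.finRange d).flatMap fun i => List.replicate (α i) i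

theorem length_multiWord (α : Fin d → ℕ) : (multiWord α).length = ∑ i, α i := by
  simp [multiWord, List.length_flatMap, Fin.sum_univ_def]

/-- The partial derivative `f^{(α)}(x)` for a multi-index `α ∈ ℕ^d`: the derivative of order `|α|`
of `f` at `x`, evaluated at `α i` copies of the basis vector `e_i` for every `i`. -/
noncomputable def multiDeriv (f : Eucl d → ℂ) (α : Fin d → ℕ) (x : Eucl d) : ℂ :=
  iteratedFDeriv ℝ (multiWord α).length f x
    (fun k => EuclideanSpace.single ((multiWord α).get k) (1 : ℝ))

/-- The space `𝓔(U)` of smooth complex-valued functions on the open set `U`. A function on `U` is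
represented by its extension by zero to `ℝ^d`. -/
def smoothOn (U : TopologicalSpace.Opens (Eucl d)) : Submodule ℂ (Eucl d → ℂ) where
  carrier := {f | ContDiffOn ℝ ((⊤ : ℕ∞) : WithTop ℕ∞) f U ∧ ∀ x ∉ U, f x = 0}
  add_mem' := fun hf hg =>
    ⟨hf.1.add hg.1, fun x hx => by simp [hf.2 x hx, hg.2 x hx]⟩
  zero_mem' := ⟨contDiffOn_const, fun _ _ => rfl⟩
  smul_mem' := fun c f hf =>
    ⟨hf.1.const_smul c, fun x hx => by simp [hf.2 x hx]⟩

theorem contDiffAt_of_mem_smoothOn {U : TopologicalSpace.Opens (Eucl d)} {f : Eucl d → ℂ}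
    (hf : f ∈ smoothOn U) {x : Eucl d} (hx : x ∈ U) (n : ℕ) : ContDiffAt ℝ n f x :=
  (hf.1.contDiffAt (U.isOpen.mem_nhds hx)).of_le (by exact_mod_cast le_top)

theorem multiDeriv_add {f g : Eucl d → ℂ} {x : Eucl d} (α : Fin d → ℕ)
    (hf : ∀ n : ℕ, ContDiffAt ℝ n f x) (hg : ∀ n : ℕ, ContDiffAt ℝ n g x) :
    multiDeriv (f + g) α x = multiDeriv f α x + multiDeriv g α x := by
  simp only [multiDeriv]
  rw [iteratedFDeriv_add_apply (hf _) (hg _)]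
  rfl

theorem multiDeriv_smul {f : Eucl d → ℂ} {x : Eucl d} (α : Fin d → ℕ) (c : ℂ)
    (hf : ∀ n : ℕ, ContDiffAt ℝ n f x) :
    multiDeriv (c • f) α x = c * multiDeriv f α x := by
  simp only [multiDeriv]
  rw [iteratedFDeriv_const_smul_apply (hf _)]
  rfl

theorem multiDeriv_zero (α : Fin d → ℕ) (x : Eucl d) :
    multiDeriv (0 : Eucl d → ℂ) α x = 0 := by
  have h := multiDeriv_smul (f := (0 : Eucl d → ℂ)) (x := x) α 0 (fun n => contDiffAt_const)
  simpa using h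

theorem multiDeriv_congr {f g : Eucl d → ℂ} {x : Eucl d} (α : Fin d → ℕ) (h : f =ᶠ[𝓝 x] g) :
    multiDeriv f α x = multiDeriv g α x := by
  simp only [multiDeriv]
  rw [(h.iteratedFDeriv ℝ _).eq_of_nhds]

theorem continuousAt_multiDeriv {f : Eucl d → ℂ} {x : Eucl d} (α : Fin d → ℕ)
    (hf : ∀ n : ℕ, ContDiffAt ℝ n f x) : ContinuousAt (multiDeriv f α) x := by
  have h := (hf _).continuousAt_iteratedFDeriv (k := (multiWord α).length) le_rfl
  exact (continuous_eval_const _).continuousAt.comp h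

/-! ### The weighted norms -/

/-- `sup_{α ∈ ℕ^d, x ∈ S} |f^{(α)}(x)| / v_{|α|}`, with values in `[0,∞]`. -/
noncomputable def wnorm (v : ℕ → ℝ) (S : Set (Eucl d)) (f : Eucl d → ℂ) : ℝ≥0∞ :=
  ⨆ α : Fin d → ℕ, ⨆ x ∈ S, ‖multiDeriv f α x‖ₑ / ENNReal.ofReal (v (∑ i, α i))

theorem wnorm_anti {v w : ℕ → ℝ} (h : v ≤ w) (S : Set (Eucl d)) (f : Eucl d → ℂ) :
    wnorm w S f ≤ wnorm v S f :=
  iSup_mono fun _ => iSup₂_mono fun _ _ =>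
    ENNReal.div_le_div_left (ENNReal.ofReal_le_ofReal (h _)) _

theorem wnorm_zero (v : ℕ → ℝ) (S : Set (Eucl d)) : wnorm v S (0 : Eucl d → ℂ) = 0 := by
  simp [wnorm, multiDeriv_zero]

theorem wnorm_add_le (v : ℕ → ℝ) {S : Set (Eucl d)} {U : TopologicalSpace.Opens (Eucl d)}
    (hS : S ⊆ U) {f g : Eucl d → ℂ} (hf : f ∈ smoothOn U) (hg : g ∈ smoothOn U) :
    wnorm v S (f + g) ≤ wnorm v S f + wnorm v S g := by
  refine iSup_le fun α => iSup₂_le fun x hx => ?_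
  rw [multiDeriv_add α (contDiffAt_of_mem_smoothOn hf (hS hx))
    (contDiffAt_of_mem_smoothOn hg (hS hx))]
  refine (ENNReal.div_le_div_right (enorm_add_le _ _) _).trans ?_
  rw [ENNReal.add_div]
  exact add_le_add
    (le_iSup_of_le α (le_iSup₂_of_le (f := fun y (_ : y ∈ S) =>
      ‖multiDeriv f α y‖ₑ / ENNReal.ofReal (v (∑ i, α i))) x hx le_rfl))
    (le_iSup_of_le α (le_iSup₂_of_le (f := fun y (_ : y ∈ S) =>
      ‖multiDeriv g α y‖ₑ / ENNReal.ofReal (v (∑ i, α i))) x hx le_rfl))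

theorem wnorm_smul (v : ℕ → ℝ) {S : Set (Eucl d)} {U : TopologicalSpace.Opens (Eucl d)}
    (hS : S ⊆ U) (c : ℂ) {f : Eucl d → ℂ} (hf : f ∈ smoothOn U) :
    wnorm v S (c • f) = ‖c‖ₑ * wnorm v S f := by
  simp only [wnorm, ENNReal.mul_iSup]
  refine iSup_congr fun α => iSup_congr fun x => iSup_congr fun hx => ?_
  rw [multiDeriv_smul α c (contDiffAt_of_mem_smoothOn hf (hS hx)), enorm_mul, mul_div_assoc]

/-! ### The spaces over compact sets -/

/-- The sufficiently regular compact sets: compact sets which are the closure of their interior. -/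
def IsRegularCompact (K : Set (Eucl d)) : Prop := IsCompact K ∧ closure (interior K) = K

/-- The interior of `K`, as an open set. -/
abbrev inside (K : Set (Eucl d)) : TopologicalSpace.Opens (Eucl d) :=
  TopologicalSpace.Opens.interior K

/-- The space `𝓔(K)` (used for `K` regular compact): the smooth functions on the interior of `K`
all of whose partial derivatives extend continuously to `K`. An element is represented by its
values on the interior, where it is determined by continuity. -/
def smoothOnCompact (K : Set (Eucl d)) : Submodule ℂ (Eucl d → ℂ) where
  carrier := {f | f ∈ smoothOn (inside K) ∧ ∀ α, ∃ g : Eucl d → ℂ,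
    ContinuousOn g K ∧ EqOn (multiDeriv f α) g (interior K)}
  add_mem' := by
    rintro f₁ f₂ ⟨h₁, H₁⟩ ⟨h₂, H₂⟩
    refine ⟨add_mem h₁ h₂, fun α => ?_⟩
    obtain ⟨g₁, c₁, e₁⟩ := H₁ α
    obtain ⟨g₂, c₂, e₂⟩ := H₂ α
    refine ⟨g₁ + g₂, c₁.add c₂, fun x hx => ?_⟩
    rw [multiDeriv_add α (contDiffAt_of_mem_smoothOn h₁ hx) (contDiffAt_of_mem_smoothOn h₂ hx),
      e₁ hx, e₂ hx, Pi.add_apply]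
  zero_mem' := ⟨zero_mem _, fun α => ⟨0, continuousOn_const, fun x _ => multiDeriv_zero α x⟩⟩
  smul_mem' := by
    rintro c f ⟨h, H⟩
    refine ⟨Submodule.smul_mem _ c h, fun α => ?_⟩
    obtain ⟨g, cg, e⟩ := H α
    refine ⟨c • g, cg.const_smul c, fun x hx => ?_⟩
    rw [multiDeriv_smul α c (contDiffAt_of_mem_smoothOn h hx), e hx, Pi.smul_apply, smul_eq_mul]

/-- The space `𝓔_v(K)` of all `f ∈ 𝓔(K)` with `sup_{α, x ∈ K} |f^{(α)}(x)| / v_{|α|} < ∞`. By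
continuity the supremum may be taken over the interior of `K`. -/
def stepSpace (v : ℕ → ℝ) (K : Set (Eucl d)) : Submodule ℂ (Eucl d → ℂ) where
  carrier := {f | f ∈ smoothOnCompact K ∧ wnorm v (interior K) f < ⊤}
  add_mem' := fun hf hg => ⟨add_mem hf.1 hg.1,
    (wnorm_add_le v (S := interior K) (U := inside K) Subset.rfl hf.1.1 hg.1.1).trans_lt
      (ENNReal.add_lt_top.2 ⟨hf.2, hg.2⟩)⟩
  zero_mem' := ⟨zero_mem _, by simp [wnorm_zero]⟩
  smul_mem' := fun c f hf => ⟨Submodule.smul_mem _ c hf.1, by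
    rw [wnorm_smul v (S := interior K) (U := inside K) Subset.rfl c hf.1.1]
    exact ENNReal.mul_lt_top enorm_lt_top hf.2⟩

/-- The norm of `𝓔_v(K)`. -/
noncomputable def stepNorm (v : ℕ → ℝ) (K : Set (Eucl d)) : Seminorm ℂ (stepSpace v K) where
  toFun f := (wnorm v (interior K) f.1).toReal
  map_zero' := by simp [wnorm_zero]
  add_le' f g := by
    rw [← ENNReal.toReal_add f.2.2.ne g.2.2.ne]
    exact ENNReal.toReal_mono (ENNReal.add_lt_top.2 ⟨f.2.2, g.2.2⟩).ne
      (wnorm_add_le v (S := interior K) (U := inside K) Subset.rfl f.2.1.1 g.2.1.1)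
  neg' f := by
    have h := wnorm_smul v (S := interior K) (U := inside K) Subset.rfl (-1) f.2.1.1
    simp only [neg_smul, one_smul, enorm_neg, enorm_one, one_mul] at h
    simp only [NegMemClass.coe_neg]
    rw [h]
  smul' c f := by
    have h := wnorm_smul v (S := interior K) (U := inside K) Subset.rfl c f.2.1.1
    simp only [SetLike.val_smul]
    rw [h, ENNReal.toReal_mul, toReal_enorm]

/-- The norm topology of `𝓔_v(K)`. -/
@[reducible]
noncomputable def stepTopology (v : ℕ → ℝ) (K : Set (Eucl d)) :
    TopologicalSpace (stepSpace v K) :=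
  (stepNorm v K).toAddGroupSeminorm.toSeminormedAddCommGroup.toUniformSpace.toTopologicalSpace

variable {ι : Type} [Nonempty ι]

/-- The union over `i` of the spaces `𝓔_{w i}(K)`, for a directed family `w` of weights. -/
def unionSpace (w : ι → ℕ → ℝ) (hw : Directed (· ≤ ·) w) (K : Set (Eucl d)) :
    Submodule ℂ (Eucl d → ℂ) where
  carrier := ⋃ i, (stepSpace (w i) K : Set (Eucl d → ℂ))
  add_mem' := by
    intro f g hf hg
    obtain ⟨i, hi⟩ := mem_iUnion.1 hf
    obtain ⟨j, hj⟩ := mem_iUnion.1 hg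
    obtain ⟨k, hik, hjk⟩ := hw i j
    exact mem_iUnion.2 ⟨k, add_mem
      (show f ∈ stepSpace (w k) K from ⟨hi.1, (wnorm_anti hik _ _).trans_lt hi.2⟩)
      (show g ∈ stepSpace (w k) K from ⟨hj.1, (wnorm_anti hjk _ _).trans_lt hj.2⟩)⟩
  zero_mem' := mem_iUnion.2 ⟨Classical.arbitrary ι, zero_mem _⟩
  smul_mem' := by
    intro c f hf
    obtain ⟨i, hi⟩ := mem_iUnion.1 hf
    exact mem_iUnion.2 ⟨i, Submodule.smul_mem _ c hi⟩

theorem stepSpace_le_unionSpace (w : ι → ℕ → ℝ) (hw : Directed (· ≤ ·) w) (K : Set (Eucl d))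
    (i : ι) : stepSpace (w i) K ≤ unionSpace w hw K :=
  fun _ hf => mem_iUnion.2 ⟨i, hf⟩

/-- The locally convex inductive limit topology on the union of the spaces `𝓔_{w i}(K)`: the finest
locally convex vector space topology for which all inclusions `𝓔_{w i}(K) → ⋃ i, 𝓔_{w i}(K)` are
continuous. (In the order on `TopologicalSpace`, finer topologies are smaller.) -/
@[reducible]
noncomputable def indLimTopology (w : ι → ℕ → ℝ) (hw : Directed (· ≤ ·) w) (K : Set (Eucl d)) :
    TopologicalSpace (unionSpace w hw K) :=
  sInf {t | @IsTopologicalAddGroup _ t _ ∧ @ContinuousSMul ℂ _ _ _ t ∧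
    @LocallyConvexSpace ℝ _ _ _ _ _ t ∧
    ∀ i, @Continuous _ _ (stepTopology (w i) K) t
      (Submodule.inclusion (stepSpace_le_unionSpace w hw K i))}

/-! ### Restriction from open sets to compact subsets -/

/-- The restriction to `K` (represented by the values on the interior of `K`). -/
noncomputable def restr (K : Set (Eucl d)) (f : Eucl d → ℂ) : Eucl d → ℂ :=
  (interior K).indicator f

theorem multiDeriv_restr (K : Set (Eucl d)) (f : Eucl d → ℂ) (α : Fin d → ℕ) {x : Eucl d}
    (hx : x ∈ interior K) : multiDeriv (restr K f) α x = multiDeriv f α x :=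
  multiDeriv_congr α (by
    filter_upwards [isOpen_interior.mem_nhds hx] with y hy
    exact indicator_of_mem hy f)

theorem restr_mem_smoothOnCompact {U : TopologicalSpace.Opens (Eucl d)} {K : Set (Eucl d)}
    (hK : K ⊆ U) {f : Eucl d → ℂ} (hf : f ∈ smoothOn U) : restr K f ∈ smoothOnCompact K := by
  refine ⟨⟨?_, fun x hx => indicator_of_notMem hx f⟩, fun α => ⟨multiDeriv f α, ?_, ?_⟩⟩
  · exact (hf.1.mono (interior_subset.trans hK)).congr fun x hx => indicator_of_mem hx f
  · exact fun x hx => (continuousAt_multiDeriv α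
      (contDiffAt_of_mem_smoothOn hf (hK hx))).continuousWithinAt
  · exact fun x hx => multiDeriv_restr K f α hx

theorem wnorm_restr_le (v : ℕ → ℝ) (K : Set (Eucl d)) (f : Eucl d → ℂ) :
    wnorm v (interior K) (restr K f) ≤ wnorm v K f := by
  refine iSup_mono fun α => iSup₂_le fun x hx => ?_
  rw [multiDeriv_restr K f α hx]
  exact le_iSup₂_of_le (f := fun y (_ : y ∈ K) =>
      ‖multiDeriv f α y‖ₑ / ENNReal.ofReal (v (∑ i, α i))) x (interior_subset hx) le_rfl

theorem restr_mem_stepSpace (v : ℕ → ℝ) {U : TopologicalSpace.Opens (Eucl d)} {K : Set (Eucl d)}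
    (hK : K ⊆ U) {f : Eucl d → ℂ} (hf : f ∈ smoothOn U) (h : wnorm v K f < ⊤) :
    restr K f ∈ stepSpace v K :=
  ⟨restr_mem_smoothOnCompact hK hf, (wnorm_restr_le v K f).trans_lt h⟩

/-! ### The classes of Roumieu and Beurling type over open sets -/

/-- A linear space of functions on `ℝ^d` together with a topology on it. -/
structure FunSpace (d : ℕ) where
  carrier : Submodule ℂ (Eucl d → ℂ)
  top : TopologicalSpace carrier

/-- Equality of two topologized function spaces: they consist of the same functions and the
identity map is a homeomorphism. -/
def FunSpace.Same (E F : FunSpace d) : Prop :=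
  ∃ h : E.carrier = F.carrier,
    @Continuous _ _ E.top F.top (Submodule.inclusion h.le) ∧
    @Continuous _ _ F.top E.top (Submodule.inclusion h.ge)

/-- The functions `f ∈ 𝓔(U)` such that for every compact `K ⊆ U` there is `i` with
`sup_{α, x ∈ K} |f^{(α)}(x)| / (w i)_{|α|} < ∞`. -/
def roumieuCarrier (w : ι → ℕ → ℝ) (hw : Directed (· ≤ ·) w)
    (U : TopologicalSpace.Opens (Eucl d)) : Submodule ℂ (Eucl d → ℂ) where
  carrier := {f | f ∈ smoothOn U ∧
    ∀ K : Set (Eucl d), IsCompact K → K ⊆ U → ∃ i, wnorm (w i) K f < ⊤}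
  add_mem' := by
    rintro f g ⟨hf, Hf⟩ ⟨hg, Hg⟩
    refine ⟨add_mem hf hg, fun K hK hKU => ?_⟩
    obtain ⟨i, hi⟩ := Hf K hK hKU
    obtain ⟨j, hj⟩ := Hg K hK hKU
    obtain ⟨k, hik, hjk⟩ := hw i j
    exact ⟨k, (wnorm_add_le (w k) hKU hf hg).trans_lt (ENNReal.add_lt_top.2
      ⟨(wnorm_anti hik _ _).trans_lt hi, (wnorm_anti hjk _ _).trans_lt hj⟩)⟩
  zero_mem' := ⟨zero_mem _, fun K _ _ => ⟨Classical.arbitrary ι, by simp [wnorm_zero]⟩⟩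
  smul_mem' := by
    rintro c f ⟨hf, Hf⟩
    refine ⟨Submodule.smul_mem _ c hf, fun K hK hKU => ?_⟩
    obtain ⟨i, hi⟩ := Hf K hK hKU
    exact ⟨i, by
      rw [wnorm_smul (w i) hKU c hf]
      exact ENNReal.mul_lt_top enorm_lt_top hi⟩

/-- The functions `f ∈ 𝓔(U)` such that for every compact `K ⊆ U` and every `i`,
`sup_{α, x ∈ K} |f^{(α)}(x)| / (w i)_{|α|} < ∞`. -/
def beurlingCarrier (w : ι → ℕ → ℝ) (U : TopologicalSpace.Opens (Eucl d)) :
    Submodule ℂ (Eucl d → ℂ) where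
  carrier := {f | f ∈ smoothOn U ∧
    ∀ K : Set (Eucl d), IsCompact K → K ⊆ U → ∀ i, wnorm (w i) K f < ⊤}
  add_mem' := by
    rintro f g ⟨hf, Hf⟩ ⟨hg, Hg⟩
    exact ⟨add_mem hf hg, fun K hK hKU i => (wnorm_add_le (w i) hKU hf hg).trans_lt
      (ENNReal.add_lt_top.2 ⟨Hf K hK hKU i, Hg K hK hKU i⟩)⟩
  zero_mem' := ⟨zero_mem _, fun K _ _ i => by simp [wnorm_zero]⟩
  smul_mem' := by
    rintro c f ⟨hf, Hf⟩
    refine ⟨Submodule.smul_mem _ c hf, fun K hK hKU i => ?_⟩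
    rw [wnorm_smul (w i) hKU c hf]
    exact ENNReal.mul_lt_top enorm_lt_top (Hf K hK hKU i)

/-- The regular compact subsets of `U`. -/
abbrev RegularCompactIn (U : TopologicalSpace.Opens (Eucl d)) : Type :=
  {K : Set (Eucl d) // IsRegularCompact K ∧ K ⊆ U}

/-- The restriction map from the Roumieu space over `U` to the inductive limit over `K`. -/
noncomputable def roumieuRestr (w : ι → ℕ → ℝ) (hw : Directed (· ≤ ·) w)
    (U : TopologicalSpace.Opens (Eucl d)) (K : RegularCompactIn U)
    (f : roumieuCarrier w hw U) : unionSpace w hw K.1 :=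
  ⟨restr K.1 f.1, by
    obtain ⟨i, hi⟩ := f.2.2 K.1 K.2.1.1 K.2.2
    exact stepSpace_le_unionSpace w hw K.1 i (restr_mem_stepSpace (w i) K.2.2 f.2.1 hi)⟩

/-- The restriction map from the Beurling space over `U` to `𝓔_{w i}(K)`. -/
noncomputable def beurlingRestr (w : ι → ℕ → ℝ) (U : TopologicalSpace.Opens (Eucl d))
    (K : RegularCompactIn U) (i : ι) (f : beurlingCarrier w U) : stepSpace (w i) K.1 :=
  ⟨restr K.1 f.1, restr_mem_stepSpace (w i) K.2.2 f.2.1 (f.2.2 K.1 K.2.1.1 K.2.2 i)⟩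

/-- The Roumieu class `lim proj_{K ⊂⊂ U} lim ind_i 𝓔_{w i}(K)`. -/
noncomputable def roumieuSpace (w : ι → ℕ → ℝ) (hw : Directed (· ≤ ·) w)
    (U : TopologicalSpace.Opens (Eucl d)) : FunSpace d where
  carrier := roumieuCarrier w hw U
  top := ⨅ K : RegularCompactIn U,
    TopologicalSpace.induced (roumieuRestr w hw U K) (indLimTopology w hw K.1)

/-- The Beurling class `lim proj_{K ⊂⊂ U} lim proj_i 𝓔_{w i}(K)`. -/
noncomputable def beurlingSpace (w : ι → ℕ → ℝ) (U : TopologicalSpace.Opens (Eucl d)) :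
    FunSpace d where
  carrier := beurlingCarrier w U
  top := ⨅ (K : RegularCompactIn U) (i : ι),
    TopologicalSpace.induced (beurlingRestr w U K i) (stepTopology (w i) K.1)

end Ultra

/-- `𝓔_{M}(U)` (Roumieu type), for a weight matrix `M`. -/
noncomputable def WeightMatrix.roumieu {d : ℕ} (M : WeightMatrix)
    (U : TopologicalSpace.Opens (Eucl d)) : FunSpace d :=
  roumieuSpace M.weights M.weights_directed U

/-- `𝓔_(M)(U)` (Beurling type), for a weight matrix `M`. -/
noncomputable def WeightMatrix.beurling {d : ℕ} (M : WeightMatrix)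
    (U : TopologicalSpace.Opens (Eucl d)) : FunSpace d :=
  beurlingSpace M.weights U

/-- `𝓔_{ω}(U)` (Roumieu type), for a weight function `ω`. -/
noncomputable def WeightFunction.roumieu {d : ℕ} (ω : WeightFunction)
    (U : TopologicalSpace.Opens (Eucl d)) : FunSpace d :=
  roumieuSpace ω.weights ω.weights_directed U

/-- `𝓔_(ω)(U)` (Beurling type), for a weight function `ω`. -/
noncomputable def WeightFunction.beurling {d : ℕ} (ω : WeightFunction)
    (U : TopologicalSpace.Opens (Eucl d)) : FunSpace d :=
  beurlingSpace ω.weights U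

/-! Both kinds of spaces depend only on the family of weights up to mutual domination by constants
(`roumieuSpace_same`, `beurlingSpace_same`), so the theorem becomes a comparison of weights,
provided that equality of spaces gives domination back. For Roumieu classes the inclusion of sets
suffices: a log-convex `v` has a smooth function, a sum of exponentials, whose derivatives are
bounded by `2 v` and at one point are at least `2^{-j} v_j` (`dominated_of_roumieuCarrier_le`). For
Beurling classes continuity of the inclusion is tested on single exponentials whose frequency is a
quotient `v_{j+1} / v_j` (`dominated_of_continuous_beurling`). Functions of one coordinate carry
both tests to every nonempty open set in positive dimension.

From `ω` to `N`: take the weights of `ω`, normalized at `j = 0`. Rescaling the parameter gives the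
condition on powers, midpoint convexity of the Young conjugate gives moderate growth, and `ω(2t) =
O(ω(t))` gives the condition (L).

From `N` to `ω`: take `ω(t) = sup_j log (t^j / N_j)` for one member of `N`. Log-convexity makes the
passage from `log N_j` to this supremum a reversible, order-reversing conjugation, so dominations of
sequences become inequalities between associated functions. The condition on powers makes all of
these functions comparable up to a factor; (L) with powers gives doubling; (L) with moderate growth
yields `2 ω_γ ≤ ω_α + C`, which iterates to arbitrarily large factors and so reaches every parameter
`s` in the weights of `ω`. -/

/-! ### Comparison of weights -/

/-- Domination of weights up to a multiplicative constant. -/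
def Dominated (v w : ℕ → ℝ) : Prop := ∃ C : ℝ, 0 < C ∧ ∀ j, v j ≤ C * w j

theorem Dominated.trans {u v w : ℕ → ℝ} (h₁ : Dominated u v) (h₂ : Dominated v w) :
    Dominated u w := by
  obtain ⟨C, hC, h⟩ := h₁
  obtain ⟨D, hD, h'⟩ := h₂
  refine ⟨C * D, mul_pos hC hD, fun j => (h j).trans ?_⟩
  rw [mul_assoc]
  exact mul_le_mul_of_nonneg_left (h' j) hC.le

theorem continuous_of_seminorm_le {E F : Type*} [AddCommGroup E] [Module ℂ E] [AddCommGroup F]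
    [Module ℂ F] (p : Seminorm ℂ E) (q : Seminorm ℂ F) (f : E →ₗ[ℂ] F) {C : ℝ}
    (h : ∀ x, q (f x) ≤ C * p x) :
    @Continuous _ _
      p.toAddGroupSeminorm.toSeminormedAddCommGroup.toUniformSpace.toTopologicalSpace
      q.toAddGroupSeminorm.toSeminormedAddCommGroup.toUniformSpace.toTopologicalSpace f := by
  let _ := p.toAddGroupSeminorm.toSeminormedAddCommGroup
  let _ := q.toAddGroupSeminorm.toSeminormedAddCommGroup
  exact AddMonoidHomClass.continuous_of_bound f C h

theorem mem_nhds_zero_of_seminorm {E : Type*} [AddCommGroup E] [Module ℂ E] (p : Seminorm ℂ E)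
    {s : Set E} (hs : s ∈ @nhds _
      p.toAddGroupSeminorm.toSeminormedAddCommGroup.toUniformSpace.toTopologicalSpace 0) :
    ∃ δ : ℝ, 0 < δ ∧ ∀ x, p x < δ → x ∈ s := by
  let _ := p.toAddGroupSeminorm.toSeminormedAddCommGroup
  obtain ⟨δ, hδ, hb⟩ := Metric.mem_nhds_iff.1 hs
  exact ⟨δ, hδ, fun x hx => hb (mem_ball_zero_iff.2 hx)⟩

section Comparison

variable {d : ℕ}

theorem wnorm_le_of_le_mul {v w : ℕ → ℝ} {C : ℝ} (hC : 0 < C) (h : ∀ j, v j ≤ C * w j)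
    (S : Set (Eucl d)) (f : Eucl d → ℂ) :
    wnorm w S f ≤ ENNReal.ofReal C * wnorm v S f := by
  have hC0 : ENNReal.ofReal C ≠ 0 := by simpa using hC
  simp only [wnorm, ENNReal.mul_iSup]
  refine iSup_mono fun α => iSup₂_mono fun x _ => ?_
  have h1 : ENNReal.ofReal (v (∑ i, α i)) ≤
      ENNReal.ofReal C * ENNReal.ofReal (w (∑ i, α i)) := by
    rw [← ENNReal.ofReal_mul hC.le]
    exact ENNReal.ofReal_le_ofReal (h _)
  calc ‖multiDeriv f α x‖ₑ / ENNReal.ofReal (w (∑ i, α i))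
      = ENNReal.ofReal C * (‖multiDeriv f α x‖ₑ /
          (ENNReal.ofReal C * ENNReal.ofReal (w (∑ i, α i)))) := by
        rw [← mul_div_assoc, ENNReal.mul_div_mul_left _ _ hC0 ENNReal.ofReal_ne_top]
    _ ≤ _ := by gcongr

theorem wnorm_lt_top_of_dominated {v w : ℕ → ℝ} (h : Dominated v w) {S : Set (Eucl d)}
    {f : Eucl d → ℂ} (hf : wnorm v S f < ⊤) : wnorm w S f < ⊤ := by
  obtain ⟨C, hC, h⟩ := h
  exact (wnorm_le_of_le_mul hC h S f).trans_lt (ENNReal.mul_lt_top ENNReal.ofReal_lt_top hf)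

theorem stepSpace_mono {v w : ℕ → ℝ} (h : Dominated v w) (K : Set (Eucl d)) :
    stepSpace v K ≤ stepSpace w K :=
  fun _ hf => ⟨hf.1, wnorm_lt_top_of_dominated h hf.2⟩

theorem stepNorm_apply (v : ℕ → ℝ) (K : Set (Eucl d)) (f : stepSpace v K) :
    stepNorm v K f = (wnorm v (interior K) f.1).toReal := rfl

theorem stepNorm_inclusion_le {v w : ℕ → ℝ} {C : ℝ} (hC : 0 < C) (h : ∀ j, v j ≤ C * w j)
    (K : Set (Eucl d)) (f : stepSpace v K) :
    stepNorm w K (Submodule.inclusion (stepSpace_mono ⟨C, hC, h⟩ K) f) ≤ C * stepNorm v K f := by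
  have h1 := ENNReal.toReal_mono (ENNReal.mul_lt_top ENNReal.ofReal_lt_top f.2.2).ne
    (wnorm_le_of_le_mul hC h (interior K) f.1)
  rw [ENNReal.toReal_mul, ENNReal.toReal_ofReal hC.le] at h1
  rw [stepNorm_apply, stepNorm_apply, Submodule.coe_inclusion]
  exact h1

theorem continuous_stepSpace_inclusion {v w : ℕ → ℝ} (h : Dominated v w) (K : Set (Eucl d)) :
    @Continuous _ _ (stepTopology v K) (stepTopology w K)
      (Submodule.inclusion (stepSpace_mono h K)) := by
  obtain ⟨C, hC, h'⟩ := id h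
  exact continuous_of_seminorm_le (stepNorm v K) (stepNorm w K)
    (Submodule.inclusion (stepSpace_mono h K)) (stepNorm_inclusion_le hC h' K)

variable {ι κ : Type}

section Roumieu

variable [Nonempty ι] [Nonempty κ]

theorem unionSpace_mono {w : ι → ℕ → ℝ} (hw : Directed (· ≤ ·) w) {w' : κ → ℕ → ℝ}
    (hw' : Directed (· ≤ ·) w') (h : ∀ i, ∃ k, Dominated (w i) (w' k)) (K : Set (Eucl d)) :
    unionSpace w hw K ≤ unionSpace w' hw' K := by
  intro f hf
  obtain ⟨i, hi⟩ := mem_iUnion.1 hf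
  obtain ⟨k, hk⟩ := h i
  exact mem_iUnion.2 ⟨k, stepSpace_mono hk K hi⟩

/-- The inductive limit topology is an infimum of admissible topologies. Each admissible topology on
the target pulls back along the inclusion to an admissible one on the source, so the source topology
is finer than the pullback. -/
theorem continuous_unionSpace_inclusion {w : ι → ℕ → ℝ} (hw : Directed (· ≤ ·) w)
    {w' : κ → ℕ → ℝ} (hw' : Directed (· ≤ ·) w') (h : ∀ i, ∃ k, Dominated (w i) (w' k))
    (K : Set (Eucl d)) :
    @Continuous _ _ (indLimTopology w hw K) (indLimTopology w' hw' K)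
      (Submodule.inclusion (unionSpace_mono hw hw' h K)) := by
  refine continuous_sInf_rng.2 fun t ht => ?_
  obtain ⟨h1, h2, h3, h4⟩ := ht
  refine continuous_sInf_dom (t := t.induced (Submodule.inclusion (unionSpace_mono hw hw' h K)))
    ⟨?_, ?_, ?_, fun i => ?_⟩ continuous_induced_dom
  · exact topologicalAddGroup_induced (Submodule.inclusion (unionSpace_mono hw hw' h K))
  · exact continuousSMul_induced (Submodule.inclusion (unionSpace_mono hw hw' h K))
  · exact LocallyConvexSpace.induced
      ((Submodule.inclusion (unionSpace_mono hw hw' h K)).restrictScalars ℝ)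
  · obtain ⟨k, hk⟩ := h i
    exact continuous_induced_rng.2
      (@Continuous.comp _ _ _ (stepTopology (w i) K) (stepTopology (w' k) K) t _ _ (h4 k)
        (continuous_stepSpace_inclusion hk K))

theorem roumieuCarrier_mono {w : ι → ℕ → ℝ} (hw : Directed (· ≤ ·) w) {w' : κ → ℕ → ℝ}
    (hw' : Directed (· ≤ ·) w') (h : ∀ i, ∃ k, Dominated (w i) (w' k))
    (U : TopologicalSpace.Opens (Eucl d)) :
    roumieuCarrier w hw U ≤ roumieuCarrier w' hw' U := by
  rintro f ⟨hf, H⟩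
  refine ⟨hf, fun K hK hKU => ?_⟩
  obtain ⟨i, hi⟩ := H K hK hKU
  obtain ⟨k, hk⟩ := h i
  exact ⟨k, wnorm_lt_top_of_dominated hk hi⟩

theorem continuous_roumieu_inclusion {w : ι → ℕ → ℝ} (hw : Directed (· ≤ ·) w)
    {w' : κ → ℕ → ℝ} (hw' : Directed (· ≤ ·) w') (h : ∀ i, ∃ k, Dominated (w i) (w' k))
    (U : TopologicalSpace.Opens (Eucl d)) :
    @Continuous _ _ (roumieuSpace w hw U).top (roumieuSpace w' hw' U).top
      (Submodule.inclusion (roumieuCarrier_mono hw hw' h U)) := by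
  refine continuous_iInf_rng.2 fun K => continuous_induced_rng.2 ?_
  refine continuous_iInf_dom (i := K) ?_
  exact @Continuous.comp (roumieuCarrier w hw U) _ _ (_) (indLimTopology w hw K.1)
    (indLimTopology w' hw' K.1) (roumieuRestr w hw U K) _ (continuous_unionSpace_inclusion hw hw' h K.1) continuous_induced_dom

/-- Mutually dominating families of weights define the same Roumieu spaces. -/
theorem roumieuSpace_same {w : ι → ℕ → ℝ} (hw : Directed (· ≤ ·) w) {w' : κ → ℕ → ℝ}
    (hw' : Directed (· ≤ ·) w') (h : ∀ i, ∃ k, Dominated (w i) (w' k))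
    (h' : ∀ k, ∃ i, Dominated (w' k) (w i)) (U : TopologicalSpace.Opens (Eucl d)) :
    (roumieuSpace w hw U).Same (roumieuSpace w' hw' U) :=
  ⟨le_antisymm (roumieuCarrier_mono hw hw' h U) (roumieuCarrier_mono hw' hw h' U),
    continuous_roumieu_inclusion hw hw' h U, continuous_roumieu_inclusion hw' hw h' U⟩

end Roumieu

theorem beurlingCarrier_mono {w : ι → ℕ → ℝ} {w' : κ → ℕ → ℝ}
    (h : ∀ k, ∃ i, Dominated (w i) (w' k)) (U : TopologicalSpace.Opens (Eucl d)) :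
    beurlingCarrier w U ≤ beurlingCarrier w' U := by
  rintro f ⟨hf, H⟩
  refine ⟨hf, fun K hK hKU k => ?_⟩
  obtain ⟨i, hi⟩ := h k
  exact wnorm_lt_top_of_dominated hi (H K hK hKU i)

theorem continuous_beurling_inclusion {w : ι → ℕ → ℝ} {w' : κ → ℕ → ℝ}
    (h : ∀ k, ∃ i, Dominated (w i) (w' k)) (U : TopologicalSpace.Opens (Eucl d)) :
    @Continuous _ _ (beurlingSpace w U).top (beurlingSpace w' U).top
      (Submodule.inclusion (beurlingCarrier_mono h U)) := by
  refine continuous_iInf_rng.2 fun K => continuous_iInf_rng.2 fun k =>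
    continuous_induced_rng.2 ?_
  obtain ⟨i, hi⟩ := h k
  refine continuous_iInf_dom (i := K) (continuous_iInf_dom (i := i) ?_)
  exact @Continuous.comp (beurlingCarrier w U) _ _ (_) (stepTopology (w i) K.1)
    (stepTopology (w' k) K.1) (beurlingRestr w U K i) _ (continuous_stepSpace_inclusion hi K.1) continuous_induced_dom

/-- Mutually dominating families of weights define the same Beurling spaces. -/
theorem beurlingSpace_same {w : ι → ℕ → ℝ} {w' : κ → ℕ → ℝ}
    (h : ∀ k, ∃ i, Dominated (w i) (w' k)) (h' : ∀ i, ∃ k, Dominated (w' k) (w i))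
    (U : TopologicalSpace.Opens (Eucl d)) :
    (beurlingSpace w U).Same (beurlingSpace w' U) :=
  ⟨le_antisymm (beurlingCarrier_mono h U) (beurlingCarrier_mono h' U),
    continuous_beurling_inclusion h U, continuous_beurling_inclusion h' U⟩

/-- A neighbourhood of zero involves only finitely many pairs `(K, i)`; the meet of their indices
and the minimum of their radii serve for all. Asking for the bound on every `K` and every `i ≥ i₀`
costs nothing later, since exponentials satisfy it uniformly. -/
theorem beurling_basis_zero {ι : Type} [SemilatticeInf ι] [Nonempty ι] {w : ι → ℕ → ℝ}
    (U : TopologicalSpace.Opens (Eucl d)) {V : Set (beurlingCarrier w U)}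
    (hV : V ∈ @nhds _ (beurlingSpace w U).top 0) :
    ∃ (i₀ : ι) (ε : ℝ), 0 < ε ∧ ∀ f : beurlingCarrier w U,
      (∀ (K : RegularCompactIn U) (i : ι), i₀ ≤ i →
        stepNorm (w i) K.1 (beurlingRestr w U K i f) < ε) → f ∈ V := by
  have hV' : V ∈ ⨅ p : RegularCompactIn U × ι, Filter.comap (beurlingRestr w U p.1 p.2)
      (@nhds _ (stepTopology (w p.2) p.1.1) (beurlingRestr w U p.1 p.2 0)) := by
    rw [iInf_prod]
    have e : @nhds _ (beurlingSpace w U).top 0 = ⨅ (K : RegularCompactIn U) (i : ι),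
        Filter.comap (beurlingRestr w U K i)
          (@nhds _ (stepTopology (w i) K.1) (beurlingRestr w U K i 0)) :=
      nhds_iInf.trans (iInf_congr fun K => nhds_iInf.trans (iInf_congr fun i =>
        @nhds_induced _ _ (stepTopology (w i) K.1) (beurlingRestr w U K i) 0))
    exact e ▸ hV
  refine iInf_sets_induct hV' ?_ ?_
  · exact ⟨Classical.arbitrary ι, 1, one_pos, fun _ _ => mem_univ _⟩
  · rintro ⟨K, i⟩ s₁ s₂ h₁ ⟨i₀, ε, hε, H⟩
    obtain ⟨t, ht, hts⟩ := h₁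
    have h0 : beurlingRestr w U K i 0 = 0 := Subtype.ext (by simp [beurlingRestr, restr])
    simp only [h0] at ht
    obtain ⟨δ, hδ, hb⟩ := mem_nhds_zero_of_seminorm (stepNorm (w i) K.1) ht
    refine ⟨i₀ ⊓ i, min δ ε, lt_min hδ hε, fun f hf => ⟨hts (hb _ ?_), H f fun K' i' hi' =>
      (hf K' i' (inf_le_left.trans hi')).trans_le (min_le_right _ _)⟩⟩
    exact (hf K i inf_le_right).trans_le (min_le_left _ _)

end Comparison

/-! ### Log-convex sequences -/

/-- A convex sequence lies above its tangent lines. -/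
theorem convexSeq_tangent_le {a : ℕ → ℝ} (ha : ∀ j, 2 * a (j + 1) ≤ a j + a (j + 2)) (j k : ℕ) :
    a j + ((k : ℝ) - j) * (a (j + 1) - a j) ≤ a k := by
  have hd : Monotone fun j => a (j + 1) - a j :=
    monotone_nat_of_le_succ fun n => by have := ha n; simp only [add_assoc]; norm_num; linarith
  rcases le_total j k with h | h
  · obtain ⟨n, rfl⟩ := Nat.exists_eq_add_of_le h
    clear h
    induction n with
    | zero => simp
    | succ n ih =>
      have := hd (Nat.le_add_right j n)
      simp only [← add_assoc] at this ⊢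
      push_cast at ih ⊢
      linarith
  · obtain ⟨n, rfl⟩ := Nat.exists_eq_add_of_le h
    clear h
    have key : ∀ m ≤ n, a (k + m) - a k ≤ m * (a (k + n + 1) - a (k + n)) := by
      intro m hm
      induction m with
      | zero => simp
      | succ m ih =>
        have h1 := hd (show k + m ≤ k + n by omega)
        have h2 := ih (by omega)
        simp only [← add_assoc] at h1 ⊢
        push_cast
        linarith
    have := key n le_rfl
    push_cast
    linarith

/-- Positive log-convex sequences. -/
structure IsLogConvex (v : ℕ → ℝ) : Prop where
  pos : ∀ j, 0 < v j
  logConvex : ∀ j, v (j + 1) ^ 2 ≤ v j * v (j + 2)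

namespace IsLogConvex

variable {v : ℕ → ℝ}

theorem log_convexSeq (hv : IsLogConvex v) (j : ℕ) :
    2 * Real.log (v (j + 1)) ≤ Real.log (v j) + Real.log (v (j + 2)) := by
  rw [← Real.log_mul (hv.pos _).ne' (hv.pos _).ne']
  have := Real.log_le_log (pow_pos (hv.pos (j + 1)) 2) (hv.logConvex j)
  simpa [Real.log_pow] using this

/-- The quotients `v_{j+1} / v_j`. -/
noncomputable def quot (v : ℕ → ℝ) (j : ℕ) : ℝ := v (j + 1) / v j

theorem quot_pos (hv : IsLogConvex v) (j : ℕ) : 0 < quot v j := div_pos (hv.pos _) (hv.pos _)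

theorem log_quot (hv : IsLogConvex v) (j : ℕ) :
    Real.log (quot v j) = Real.log (v (j + 1)) - Real.log (v j) :=
  Real.log_div (hv.pos _).ne' (hv.pos _).ne'

theorem log_tangent_le (hv : IsLogConvex v) (j k : ℕ) :
    Real.log (v j) + ((k : ℝ) - j) * Real.log (quot v j) ≤ Real.log (v k) := by
  rw [hv.log_quot]
  exact convexSeq_tangent_le (a := fun j => Real.log (v j)) hv.log_convexSeq j k

/-- The tangent inequality in multiplicative form: for `t = quot v j` the ratio `t ^ k / v k` is
largest at `k = j`. This selects the frequencies of all test exponentials. -/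
theorem quot_pow_mul_le (hv : IsLogConvex v) (j k : ℕ) :
    quot v j ^ k * v j ≤ quot v j ^ j * v k := by
  have hq := hv.quot_pos j
  rw [← Real.log_le_log_iff (mul_pos (pow_pos hq _) (hv.pos _))
    (mul_pos (pow_pos hq _) (hv.pos _)), Real.log_mul (pow_pos hq _).ne' (hv.pos _).ne',
    Real.log_mul (pow_pos hq _).ne' (hv.pos _).ne', Real.log_pow, Real.log_pow]
  have := hv.log_tangent_le j k
  linarith

end IsLogConvex

theorem IsLC.isLogConvex {M : ℕ → ℝ} (h : IsLC M) : IsLogConvex M := ⟨h.pos, h.logConvex⟩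

/-- Every LC sequence dominates all geometric sequences. -/
theorem IsLC.dominated_pow {M : ℕ → ℝ} (h : IsLC M) (t : ℝ) :
    Dominated (fun j => t ^ j) M := by
  obtain ⟨n, hn⟩ := eventually_atTop.1 (h.tendsto.eventually_ge_atTop |t|)
  -- From `n` on, the root condition gives `|t| ^ j ≤ M j`, covered by the summand `1`; the sum
  -- absorbs the finitely many earlier ratios.
  refine ⟨1 + ∑ k ∈ Finset.range (n + 1), |t| ^ k / M k, ?_, fun j => ?_⟩
  · have : 0 ≤ ∑ k ∈ Finset.range (n + 1), |t| ^ k / M k :=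
      Finset.sum_nonneg fun k _ => div_nonneg (pow_nonneg (abs_nonneg t) k) (h.pos k).le
    linarith
  · have habs : t ^ j ≤ |t| ^ j := by rw [← abs_pow]; exact le_abs_self _
    refine habs.trans ?_
    rw [← div_le_iff₀ (h.pos j)]
    have hnn : ∀ k ∈ Finset.range (n + 1), 0 ≤ |t| ^ k / M k := fun k _ =>
      div_nonneg (pow_nonneg (abs_nonneg t) k) (h.pos k).le
    by_cases hj : j ∈ Finset.range (n + 1)
    · have := Finset.single_le_sum hnn hj
      linarith
    · have hj' : n < j := by simpa using hj
      have h1 := pow_le_pow_left₀ (abs_nonneg t) (hn j hj'.le) j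
      rw [← Real.rpow_natCast (M j ^ (1 / (j : ℝ))) j, ← Real.rpow_mul (h.pos j).le,
        one_div_mul_cancel (by exact_mod_cast (by omega : j ≠ 0)), Real.rpow_one] at h1
      have := (div_le_one (h.pos j)).2 h1
      have := Finset.sum_nonneg hnn
      linarith

/-! ### Exponentials and lacunary series -/

/-- The function `x ↦ c e^{i t (x - x₀)}`. -/
noncomputable def expWave (c t x₀ : ℝ) (x : ℝ) : ℂ :=
  c * Complex.exp (Complex.I * t * (x - x₀))

theorem contDiff_expWave (c t x₀ : ℝ) {n : WithTop ℕ∞} : ContDiff ℝ n (expWave c t x₀) := by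
  unfold expWave
  have : ContDiff ℝ n (fun x : ℝ => (x : ℂ)) := Complex.ofRealCLM.contDiff
  fun_prop

theorem iteratedDeriv_expWave (c t x₀ : ℝ) (n : ℕ) :
    iteratedDeriv n (expWave c t x₀) = fun x => (Complex.I * t) ^ n * expWave c t x₀ x := by
  induction n with
  | zero => simp
  | succ n ih =>
    rw [iteratedDeriv_succ, ih]
    funext x
    have h1 : HasDerivAt (fun x : ℝ => Complex.I * t * ((x : ℂ) - x₀)) (Complex.I * t) x := by
      simpa using (((hasDerivAt_id x).ofReal_comp).sub_const (x₀ : ℂ)).const_mul (Complex.I * t)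
    have h2 := ((h1.cexp.const_mul (c : ℂ)).const_mul ((Complex.I * t) ^ n)).deriv
    simp only [expWave] at h2 ⊢
    rw [h2]
    ring

theorem norm_expWave (c t x₀ x : ℝ) : ‖expWave c t x₀ x‖ = |c| := by
  have : Complex.I * t * ((x : ℂ) - x₀) = ((t * (x - x₀) : ℝ) : ℂ) * Complex.I := by
    push_cast; ring
  rw [expWave, norm_mul, this, Complex.norm_exp_ofReal_mul_I, mul_one, Complex.norm_real,
    Real.norm_eq_abs]

theorem norm_iteratedDeriv_expWave (c t x₀ : ℝ) (n : ℕ) (x : ℝ) :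
    ‖iteratedDeriv n (expWave c t x₀) x‖ = |t| ^ n * |c| := by
  rw [iteratedDeriv_expWave]
  simp [norm_expWave]

/-- For a log-convex sequence `v` there are smooth functions whose derivatives are bounded by `2 v`
everywhere and are not essentially smaller than `v` at a given point. -/
theorem IsLogConvex.exists_characteristic {v : ℕ → ℝ} (hv : IsLogConvex v) (x₀ : ℝ) :
    ∃ g : ℝ → ℂ, ContDiff ℝ ((⊤ : ℕ∞) : WithTop ℕ∞) g ∧
      (∀ j x, ‖iteratedDeriv j g x‖ ≤ 2 * v j) ∧
      ∀ j, (1 / 2) ^ j * v j ≤ ‖iteratedDeriv j g x₀‖ := by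
  set q := IsLogConvex.quot v with hq
  -- With frequency `q k` and this amplitude, the `k`-th exponential has `k`-th derivative of
  -- modulus `2^{-k} v k`, while the tangent inequality keeps every `j`-th derivative below `2^{-k}
  -- v j`. Hence the series may be differentiated termwise.
  set c : ℕ → ℝ := fun k => (1 / 2) ^ k * (v k / q k ^ k) with hc
  have hqp : ∀ k, 0 < q k := hv.quot_pos
  have hc0 : ∀ k, 0 < c k := fun k =>
    mul_pos (by positivity) (div_pos (hv.pos k) (pow_pos (hqp k) k))
  have hterm : ∀ j k, q k ^ j * c k ≤ (1 / 2) ^ k * v j := by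
    intro j k
    have h1 := hv.quot_pow_mul_le k j
    have h2 : q k ^ j * (v k / q k ^ k) ≤ v j := by
      rw [← mul_div_assoc, div_le_iff₀ (pow_pos (hqp k) k), mul_comm (v j)]
      exact h1
    calc q k ^ j * c k = (1 / 2) ^ k * (q k ^ j * (v k / q k ^ k)) := by simp only [hc]; ring
      _ ≤ _ := mul_le_mul_of_nonneg_left h2 (by positivity)
  set F : ℕ → ℝ → ℂ := fun k => expWave (c k) (q k) x₀ with hF
  have hFn : ∀ j k x, ‖iteratedDeriv j (F k) x‖ = q k ^ j * c k := by
    intro j k x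
    rw [hF, norm_iteratedDeriv_expWave, abs_of_pos (hqp k), abs_of_pos (hc0 k)]
  have hFd : ∀ k, ContDiff ℝ ((⊤ : ℕ∞) : WithTop ℕ∞) (F k) := fun k => contDiff_expWave _ _ _
  have hgeo : ∀ j : ℕ, HasSum (fun k : ℕ => (1 / 2 : ℝ) ^ k * v j) (2 * v j) := fun j => by
    simpa using hasSum_geometric_two.mul_right (v j)
  have hbd : ∀ (j k : ℕ) (x : ℝ), (j : ℕ∞) ≤ ⊤ →
      ‖iteratedFDeriv ℝ j (F k) x‖ ≤ (1 / 2 : ℝ) ^ k * v j := by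
    intro j k x _
    rw [norm_iteratedFDeriv_eq_norm_iteratedDeriv, hFn]
    exact hterm j k
  have hsm : ∀ j : ℕ, (j : ℕ∞) ≤ ⊤ → Summable fun k : ℕ => (1 / 2 : ℝ) ^ k * v j :=
    fun j _ => (hgeo j).summable
  have hder : ∀ (j : ℕ) (x : ℝ), HasSum (fun k => iteratedDeriv j (F k) x)
      (iteratedDeriv j (fun y => ∑' k, F k y) x) := by
    intro j x
    have hs : Summable fun k => iteratedFDeriv ℝ j (F k) x :=
      .of_norm_bounded (hgeo j).summable fun k => hbd j k x le_top
    have h1 := iteratedFDeriv_tsum_apply hFd hsm hbd (k := j) le_top x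
    have h2 : HasSum (fun k => iteratedFDeriv ℝ j (F k) x)
        (iteratedFDeriv ℝ j (fun y => ∑' k, F k y) x) := h1 ▸ hs.hasSum
    simp only [iteratedDeriv]
    exact h2.mapL (ContinuousMultilinearMap.apply ℝ (fun _ : Fin j => ℝ) ℂ fun _ => 1)
  refine ⟨fun y => ∑' k, F k y, contDiff_tsum hFd hsm hbd, fun j x => ?_, fun j => ?_⟩
  · rw [← (hder j x).tsum_eq]
    exact tsum_of_norm_bounded (hgeo j) fun k => (hFn j k x).le.trans (hterm j k)
  · have h1 := hder j x₀
    -- At `x₀` all terms of the `j`-th derivative have the same phase `I ^ j`, so nothing cancels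
    -- and the term `k = j` alone bounds the modulus from below.
    have hval : ∀ k, iteratedDeriv j (F k) x₀ = Complex.I ^ j * ((q k ^ j * c k : ℝ) : ℂ) := by
      intro k
      simp only [hF, iteratedDeriv_expWave, expWave]
      push_cast
      simp [mul_pow, mul_assoc]
    have hsumm : Summable fun k => q k ^ j * c k :=
      .of_nonneg_of_le (fun k => (mul_pos (pow_pos (hqp k) j) (hc0 k)).le) (hterm j)
        (hgeo j).summable
    have h2 : HasSum (fun k => iteratedDeriv j (F k) x₀)
        (Complex.I ^ j * ((∑' k, q k ^ j * c k : ℝ) : ℂ)) := by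
      simp only [hval]
      exact (Complex.hasSum_ofReal.2 hsumm.hasSum).mul_left _
    rw [h1.unique h2]
    simp only [norm_mul, norm_pow, Complex.norm_I, one_pow, one_mul, Complex.norm_real,
      Real.norm_eq_abs]
    refine le_trans ?_ (le_abs_self _)
    refine le_trans (le_of_eq ?_) (hsumm.le_tsum j fun k _ =>
      (mul_pos (pow_pos (hqp k) j) (hc0 k)).le)
    simp only [hc]
    have := (pow_pos (hqp j) j).ne'
    field_simp

/-! ### Functions of one coordinate -/

section Ridge

variable {d : ℕ}

/-- The function `x ↦ g (x_i)` on the open set `U`, extended by zero. -/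
noncomputable def ridge (U : TopologicalSpace.Opens (Eucl d)) (i : Fin d) (g : ℝ → ℂ) :
    Eucl d → ℂ :=
  (U : Set (Eucl d)).indicator fun x => g (x i)

variable {U : TopologicalSpace.Opens (Eucl d)} {i : Fin d} {g : ℝ → ℂ}

theorem ridge_mem_smoothOn (hg : ContDiff ℝ ((⊤ : ℕ∞) : WithTop ℕ∞) g) :
    ridge U i g ∈ smoothOn U := by
  refine ⟨?_, fun x hx => indicator_of_notMem hx _⟩
  refine ContDiffOn.congr (f := g ∘ (EuclideanSpace.proj i : Eucl d →L[ℝ] ℝ)) ?_ ?_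
  · exact (hg.comp (ContinuousLinearMap.contDiff _)).contDiffOn
  · intro x hx
    exact indicator_of_mem hx _

/-- Near a point of `U` the function is `g` composed with a coordinate projection. Each factor of
the product is `0` or `1`, and all are `1` exactly when only the `i`-th coordinate is
differentiated. -/
theorem multiDeriv_ridge (hg : ContDiff ℝ ((⊤ : ℕ∞) : WithTop ℕ∞) g) (α : Fin d → ℕ)
    {x : Eucl d} (hx : x ∈ U) :
    multiDeriv (ridge U i g) α x =
      (∏ k, (EuclideanSpace.single ((multiWord α).get k) (1 : ℝ) : Eucl d) i) •
        iteratedDeriv (∑ k, α k) g (x i) := by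
  have h1 : ridge U i g =ᶠ[𝓝 x] g ∘ (EuclideanSpace.proj i : Eucl d →L[ℝ] ℝ) := by
    filter_upwards [U.isOpen.mem_nhds hx] with y hy
    exact indicator_of_mem hy _
  rw [multiDeriv_congr α h1, multiDeriv,
    ContinuousLinearMap.iteratedFDeriv_comp_right _ hg x (by exact_mod_cast le_top),
    ContinuousMultilinearMap.compContinuousLinearMap_apply,
    iteratedFDeriv_apply_eq_iteratedDeriv_mul_prod, ← length_multiWord]
  rfl

theorem norm_multiDeriv_ridge_le (hg : ContDiff ℝ ((⊤ : ℕ∞) : WithTop ℕ∞) g) (α : Fin d → ℕ)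
    {x : Eucl d} (hx : x ∈ U) :
    ‖multiDeriv (ridge U i g) α x‖ ≤ ‖iteratedDeriv (∑ k, α k) g (x i)‖ := by
  rw [multiDeriv_ridge hg α hx, norm_smul, norm_prod]
  refine mul_le_of_le_one_left (norm_nonneg _) (Finset.prod_le_one (fun _ _ => norm_nonneg _) ?_)
  intro k _
  rw [PiLp.single_apply]
  split_ifs <;> simp

theorem multiWord_eq_of_mem {j : ℕ} {a : Fin d} (ha : a ∈ multiWord (Pi.single i j)) : a = i := by
  obtain ⟨b, -, hb⟩ := List.mem_flatMap.1 ha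
  obtain ⟨h0, rfl⟩ := List.mem_replicate.1 hb
  by_contra h
  exact h0 (Pi.single_eq_of_ne h _)

theorem multiDeriv_ridge_single (hg : ContDiff ℝ ((⊤ : ℕ∞) : WithTop ℕ∞) g) (j : ℕ)
    {x : Eucl d} (hx : x ∈ U) :
    multiDeriv (ridge U i g) (Pi.single i j) x = iteratedDeriv j g (x i) := by
  rw [multiDeriv_ridge hg _ hx, Finset.prod_eq_one, one_smul, Finset.sum_pi_single']
  · simp
  · intro k _
    rw [multiWord_eq_of_mem (List.get_mem _ k)]
    simp

theorem wnorm_ridge_le (hg : ContDiff ℝ ((⊤ : ℕ∞) : WithTop ℕ∞) g) {v : ℕ → ℝ}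
    {C : ℝ} (hC : 0 ≤ C) (h : ∀ j x, ‖iteratedDeriv j g x‖ ≤ C * v j)
    {K : Set (Eucl d)} (hK : K ⊆ U) : wnorm v K (ridge U i g) ≤ ENNReal.ofReal C := by
  refine iSup_le fun α => iSup₂_le fun x hx => ?_
  refine ENNReal.div_le_of_le_mul ?_
  rw [← ENNReal.ofReal_mul hC, ← ofReal_norm]
  exact ENNReal.ofReal_le_ofReal ((norm_multiDeriv_ridge_le hg α (hK hx)).trans (h _ _))

theorem le_wnorm_ridge (hg : ContDiff ℝ ((⊤ : ℕ∞) : WithTop ℕ∞) g) {v : ℕ → ℝ}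
    {K : Set (Eucl d)} (hK : K ⊆ U) {x : Eucl d} (hx : x ∈ K) (j : ℕ) :
    ‖iteratedDeriv j g (x i)‖ₑ / ENNReal.ofReal (v j) ≤ wnorm v K (ridge U i g) := by
  refine le_iSup_of_le (Pi.single i j) (le_iSup₂_of_le (f := fun y (_ : y ∈ K) =>
    ‖multiDeriv (ridge U i g) (Pi.single i j) y‖ₑ /
      ENNReal.ofReal (v (∑ k, (Pi.single i j : Fin d → ℕ) k))) x hx ?_)
  rw [multiDeriv_ridge_single hg j (hK hx)]
  simp

theorem norm_le_of_wnorm_ridge_le (hg : ContDiff ℝ ((⊤ : ℕ∞) : WithTop ℕ∞) g) {v : ℕ → ℝ}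
    (hv : ∀ j, 0 < v j) {K : Set (Eucl d)} (hK : K ⊆ U) {C : ℝ} (hC : 0 ≤ C)
    (h : wnorm v K (ridge U i g) ≤ ENNReal.ofReal C) {x : Eucl d} (hx : x ∈ K) (j : ℕ) :
    ‖iteratedDeriv j g (x i)‖ ≤ C * v j := by
  have h1 := (le_wnorm_ridge hg hK hx j (i := i) (v := v)).trans h
  rw [ENNReal.div_le_iff (by simpa using hv j) ENNReal.ofReal_ne_top, ← ENNReal.ofReal_mul hC,
    ← ofReal_norm] at h1
  exact (ENNReal.ofReal_le_ofReal_iff (mul_nonneg hC (hv j).le)).1 h1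

end Ridge

/-! ### Comparison of weights from comparison of spaces -/

section Converse

variable {d : ℕ} {U : TopologicalSpace.Opens (Eucl d)}

/-- The characteristic function of `v` lies in the smaller class, hence in the larger one, where its
derivatives at one point are bounded by some `w' k`. The lost factor `2^{-j}` is harmless because
`≼` ignores geometric factors. -/
theorem dominated_of_roumieuCarrier_le {ι κ : Type} [Nonempty ι] [Nonempty κ] {w : ι → ℕ → ℝ}
    {hw : Directed (· ≤ ·) w} {w' : κ → ℕ → ℝ} {hw' : Directed (· ≤ ·) w'} (hd : 0 < d)
    (hU : (U : Set (Eucl d)).Nonempty) (hpos : ∀ k j, 0 < w' k j)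
    (hle : roumieuCarrier w hw U ≤ roumieuCarrier w' hw' U) {v : ℕ → ℝ} (hv : IsLogConvex v)
    {i : ι} (hvi : Dominated v (w i)) :
    ∃ k, Dominated (fun j => (1 / 2) ^ j * v j) (w' k) := by
  obtain ⟨x, hx⟩ := hU
  obtain ⟨g, hg, hgv, hgx⟩ := hv.exists_characteristic (x ⟨0, hd⟩)
  have hf : ridge U ⟨0, hd⟩ g ∈ roumieuCarrier w hw U :=
    ⟨ridge_mem_smoothOn hg, fun K _ hK => ⟨i, wnorm_lt_top_of_dominated hvi
      ((wnorm_ridge_le hg zero_le_two hgv hK).trans_lt ENNReal.ofReal_lt_top)⟩⟩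
  obtain ⟨k, hk⟩ := (hle hf).2 {x} isCompact_singleton (singleton_subset_iff.2 hx)
  set C := (wnorm (w' k) {x} (ridge U ⟨0, hd⟩ g)).toReal with hC
  have hC0 : 0 ≤ C := ENNReal.toReal_nonneg
  refine ⟨k, C + 1, by linarith, fun j => (hgx j).trans ?_⟩
  refine (norm_le_of_wnorm_ridge_le hg (hpos k) (singleton_subset_iff.2 hx) hC0
    (ENNReal.ofReal_toReal hk.ne).ge (mem_singleton x) j).trans ?_
  nlinarith [hpos k j]

theorem restr_ridge {K : Set (Eucl d)} (hK : K ⊆ U) (i : Fin d) (g : ℝ → ℂ) :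
    restr K (ridge U i g) = ridge (inside K) i g := by
  rw [restr, ridge, indicator_indicator, inter_eq_left.2 (interior_subset.trans hK)]
  rfl

theorem isRegularCompact_closedBall (x : Eucl d) {r : ℝ} (hr : 0 < r) :
    IsRegularCompact (Metric.closedBall x r) :=
  ⟨isCompact_closedBall x r, by rw [interior_closedBall x hr.ne', closure_ball x hr.ne']⟩

theorem seminorm_lt_one_mem_nhds {E : Type*} [AddCommGroup E] [Module ℂ E] (p : Seminorm ℂ E) :
    {x | p x < 1} ∈ @nhds _
      p.toAddGroupSeminorm.toSeminormedAddCommGroup.toUniformSpace.toTopologicalSpace 0 := by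
  let _ := p.toAddGroupSeminorm.toSeminormedAddCommGroup
  exact Metric.mem_nhds_iff.2 ⟨1, one_pos, fun x hx => mem_ball_zero_iff.1 hx⟩

theorem beurlingRestr_ball_mem_nhds {ι : Type} (w : ι → ℕ → ℝ) (K : RegularCompactIn U) (i : ι) :
    {f : beurlingCarrier w U | stepNorm (w i) K.1 (beurlingRestr w U K i f) < 1} ∈
      @nhds _ (beurlingSpace w U).top 0 := by
  have hc : @Continuous _ _ (beurlingSpace w U).top (stepTopology (w i) K.1)
      (beurlingRestr w U K i) :=
    continuous_iInf_dom (i := K) (continuous_iInf_dom (i := i) continuous_induced_dom)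
  have h0 : beurlingRestr w U K i 0 = 0 := Subtype.ext (by simp [beurlingRestr, restr])
  have ht := @Continuous.tendsto (beurlingCarrier w U) _ (beurlingSpace w U).top
    (stepTopology (w i) K.1) _ hc 0
  rw [h0] at ht
  exact ht (seminorm_lt_one_mem_nhds (stepNorm (w i) K.1))

/-- Continuity at zero turns the unit ball for `w' k` on a small closed ball around a point of `U`
into a bound by `ε` for all indices beyond some `i₀`. For each `j` an exponential adapted to `w i₀`
at `j` satisfies that bound, and its `j`-th derivative shows `w i₀ j ≤ (2 / ε) w' k j`. -/
theorem dominated_of_continuous_beurling {ι κ : Type} [SemilatticeInf ι] [Nonempty ι]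
    {w : ι → ℕ → ℝ} (hmono : Monotone w) (hlc : ∀ i, IsLogConvex (w i))
    (hpow : ∀ i (t : ℝ), Dominated (fun j => t ^ j) (w i)) {w' : κ → ℕ → ℝ} (hd : 0 < d)
    (hU : (U : Set (Eucl d)).Nonempty) (hpos : ∀ k j, 0 < w' k j)
    (hle : beurlingCarrier w U ≤ beurlingCarrier w' U)
    (hc : @Continuous _ _ (beurlingSpace w U).top (beurlingSpace w' U).top
      (Submodule.inclusion hle)) (k : κ) :
    ∃ i, Dominated (w i) (w' k) := by
  obtain ⟨x, hx⟩ := hU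
  obtain ⟨r, hr, hrU⟩ := Metric.nhds_basis_closedBall.mem_iff.1 (U.isOpen.mem_nhds hx)
  let K : RegularCompactIn U :=
    ⟨Metric.closedBall x r, isRegularCompact_closedBall x hr, hrU⟩
  have hxK : x ∈ interior K.1 := by
    simp only [K, interior_closedBall x hr.ne', Metric.mem_ball_self hr]
  have ht := @Continuous.tendsto (beurlingCarrier w U) (beurlingCarrier w' U)
    (beurlingSpace w U).top (beurlingSpace w' U).top _ hc 0
  rw [map_zero] at ht
  obtain ⟨i₀, ε, hε, H⟩ := beurling_basis_zero U (ht (beurlingRestr_ball_mem_nhds w' K k))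
  refine ⟨i₀, 2 / ε, by positivity, fun j => ?_⟩
  set t := IsLogConvex.quot (w i₀) j with ht
  have ht0 : 0 < t := (hlc i₀).quot_pos j
  have htj : 0 < t ^ j := pow_pos ht0 j
  have hwj : 0 < w i₀ j := (hlc i₀).pos j
  -- The amplitude makes the `j`-th derivative have modulus `ε / 2 * w i₀ j`, while the tangent
  -- inequality keeps all other orders below `ε / 2 * w i₀ n`. Half of `ε` leaves room for the
  -- strict inequality.
  set a := ε / 2 * (w i₀ j / t ^ j) with ha
  have ha0 : 0 < a := by positivity
  have hg : ContDiff ℝ ((⊤ : ℕ∞) : WithTop ℕ∞) (expWave a t 0) := contDiff_expWave _ _ _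
  have hgn : ∀ n y, ‖iteratedDeriv n (expWave a t 0) y‖ = t ^ n * a := fun n y => by
    rw [norm_iteratedDeriv_expWave, abs_of_pos ht0, abs_of_pos ha0]
  have hgi : ∀ i, i₀ ≤ i → ∀ n y, ‖iteratedDeriv n (expWave a t 0) y‖ ≤ ε / 2 * w i n := by
    intro i hi n y
    rw [hgn]
    refine le_trans ?_ (mul_le_mul_of_nonneg_left (hmono hi n) (half_pos hε).le)
    have h1 := (hlc i₀).quot_pow_mul_le j n
    have h2 : t ^ n * (w i₀ j / t ^ j) ≤ w i₀ n := by
      rw [← mul_div_assoc, div_le_iff₀ htj, mul_comm (w i₀ n)]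
      exact h1
    calc t ^ n * a = ε / 2 * (t ^ n * (w i₀ j / t ^ j)) := by rw [ha]; ring
      _ ≤ _ := mul_le_mul_of_nonneg_left h2 (half_pos hε).le
  -- Membership requires finite norms for all indices, including those not above `i₀`; there only
  -- the domination of geometric sequences is available.
  have hf : ridge U ⟨0, hd⟩ (expWave a t 0) ∈ beurlingCarrier w U := by
    refine ⟨ridge_mem_smoothOn hg, fun K _ hK i => ?_⟩
    obtain ⟨C, hC, h⟩ := hpow i t
    refine (wnorm_ridge_le hg (mul_pos hC ha0).le (fun n y => ?_) hK).trans_lt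
      ENNReal.ofReal_lt_top
    rw [hgn]
    nlinarith [h n]
  have h1 : stepNorm (w' k) K.1 (beurlingRestr w' U K k ⟨_, hle hf⟩) < 1 := by
    refine H ⟨_, hf⟩ fun K' i hi => lt_of_le_of_lt ?_ (half_lt_self hε)
    rw [stepNorm_apply]
    refine ENNReal.toReal_le_of_le_ofReal (half_pos hε).le ?_
    exact (wnorm_restr_le _ _ _).trans
      (wnorm_ridge_le hg (half_pos hε).le (hgi i hi) K'.2.2)
  rw [stepNorm_apply] at h1
  have h2 : wnorm (w' k) (interior K.1) (ridge (inside K.1) ⟨0, hd⟩ (expWave a t 0)) ≤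
      ENNReal.ofReal 1 := by
    rw [← restr_ridge K.2.2]
    exact (ENNReal.le_ofReal_iff_toReal_le
      (beurlingRestr w' U K k ⟨_, hle hf⟩).2.2.ne zero_le_one).2 h1.le
  have h3 := norm_le_of_wnorm_ridge_le (U := inside K.1) hg (hpos k) Subset.rfl zero_le_one h2
    hxK j
  rw [hgn, one_mul] at h3
  have h4 : t ^ j * a = ε / 2 * w i₀ j := by
    rw [ha]; field_simp
  rw [h4] at h3
  calc w i₀ j = 2 / ε * (ε / 2 * w i₀ j) := by field_simp
    _ ≤ _ := mul_le_mul_of_nonneg_left h3 (by positivity)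

end Converse

/-! ### The weight function associated with a sequence -/

/-- The function `y ↦ sup_j (j y - log M_j)`. -/
noncomputable def assocTrace (M : ℕ → ℝ) (y : ℝ) : ℝ := ⨆ j : ℕ, ((j : ℝ) * y - Real.log (M j))

namespace IsLC

variable {M N : ℕ → ℝ}

theorem bddAbove_assocTrace (h : IsLC M) (y : ℝ) :
    BddAbove (range fun j : ℕ => (j : ℝ) * y - Real.log (M j)) := by
  obtain ⟨C, hC, hb⟩ := h.dominated_pow (Real.exp y)
  refine ⟨Real.log C, ?_⟩
  rintro _ ⟨j, rfl⟩
  have h1 := Real.log_le_log (pow_pos (Real.exp_pos y) j) (hb j)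
  rw [Real.log_pow, Real.log_exp, Real.log_mul hC.ne' (h.pos j).ne'] at h1
  simp only
  linarith

theorem le_assocTrace (h : IsLC M) (j : ℕ) (y : ℝ) :
    (j : ℝ) * y - Real.log (M j) ≤ assocTrace M y :=
  le_ciSup (h.bddAbove_assocTrace y) j

theorem log_nonneg (h : IsLC M) (j : ℕ) : 0 ≤ Real.log (M j) := by
  have h1 := h.isLogConvex.log_tangent_le 0 j
  rw [h.isLogConvex.log_quot, h.zero, Real.log_one] at h1
  have h2 := Real.log_nonneg h.one
  have h3 : 0 ≤ (j : ℝ) * Real.log (M 1) := by positivity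
  simp only [Nat.cast_zero, zero_add, sub_zero] at h1
  linarith

theorem log_quot_nonneg (h : IsLC M) (j : ℕ) : 0 ≤ Real.log (IsLogConvex.quot M j) := by
  rcases Nat.eq_zero_or_pos j with rfl | hj
  · rw [h.isLogConvex.log_quot, h.zero, Real.log_one, sub_zero]
    exact h.log_nonneg _
  · have h1 := h.isLogConvex.log_tangent_le j 0
    rw [h.zero, Real.log_one] at h1
    have h2 := h.log_nonneg j
    have hj' : (0 : ℝ) < j := by exact_mod_cast hj
    by_contra! h3
    have := mul_neg_of_pos_of_neg hj' h3
    simp only [Nat.cast_zero, zero_sub] at h1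
    linarith

theorem log_mono (h : IsLC M) : Monotone fun j => Real.log (M j) :=
  monotone_nat_of_le_succ fun j => by
    have h1 := h.log_quot_nonneg j
    rw [h.isLogConvex.log_quot] at h1
    linarith

theorem assocTrace_nonneg (h : IsLC M) (y : ℝ) : 0 ≤ assocTrace M y := by
  have := h.le_assocTrace 0 y
  simpa [h.zero] using this

theorem assocTrace_of_nonpos (h : IsLC M) {y : ℝ} (hy : y ≤ 0) : assocTrace M y = 0 := by
  refine le_antisymm (ciSup_le fun j => ?_) (h.assocTrace_nonneg y)
  have h1 := h.log_nonneg j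
  have h2 := mul_nonpos_of_nonneg_of_nonpos j.cast_nonneg hy (α := ℝ)
  linarith

theorem assocTrace_mono (h : IsLC M) : Monotone (assocTrace M) := fun _ z hyz =>
  ciSup_le fun j => le_trans
    (sub_le_sub_right (mul_le_mul_of_nonneg_left hyz j.cast_nonneg) _) (h.le_assocTrace j z)

theorem convexOn_assocTrace (h : IsLC M) : ConvexOn ℝ univ (assocTrace M) := by
  refine ⟨convex_univ, fun y _ z _ a b ha hb hab => ciSup_le fun j => ?_⟩
  have h1 := mul_le_mul_of_nonneg_left (h.le_assocTrace j y) ha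
  have h2 := mul_le_mul_of_nonneg_left (h.le_assocTrace j z) hb
  have h3 : Real.log (M j) = a * Real.log (M j) + b * Real.log (M j) := by
    rw [← add_mul, hab, one_mul]
  simp only [smul_eq_mul]
  nlinarith

theorem continuous_assocTrace (h : IsLC M) : Continuous (assocTrace M) :=
  continuousOn_univ.1 (h.convexOn_assocTrace.continuousOn isOpen_univ)

/-- `log M_j = sup_{y ≥ 0} (j y - ω_M(e^y))`, and the supremum is attained. -/
theorem exists_log_eq (h : IsLC M) (j : ℕ) :
    ∃ y, 0 ≤ y ∧ Real.log (M j) = j * y - assocTrace M y := by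
  refine ⟨Real.log (IsLogConvex.quot M j), h.log_quot_nonneg j, ?_⟩
  have h1 := h.le_assocTrace j (Real.log (IsLogConvex.quot M j))
  have h2 : assocTrace M (Real.log (IsLogConvex.quot M j)) ≤
      j * Real.log (IsLogConvex.quot M j) - Real.log (M j) := ciSup_le fun k => by
    have := h.isLogConvex.log_tangent_le j k
    linarith
  linarith

/-- One term of the supremum, with `n ≥ m`, already grows this fast. -/
theorem exists_le_assocTrace (h : IsLC M) (m : ℝ) :
    ∃ C, ∀ y, 0 ≤ y → m * y ≤ assocTrace M y + C := by
  obtain ⟨n, hn⟩ := exists_nat_ge m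
  refine ⟨Real.log (M n), fun y hy => ?_⟩
  have := h.le_assocTrace n y
  nlinarith

/-- The associated weight function `ω_M(t) = sup_j log (t^j / M_j)`. -/
noncomputable def weightFunction (h : IsLC M)
    (hd : ∃ C, ∀ y, 0 ≤ y → assocTrace M (y + Real.log 2) ≤ C * assocTrace M y + C) :
    WeightFunction where
  toFun t := assocTrace M (Real.log t)
  nonneg t _ := h.assocTrace_nonneg _
  continuousOn := by
    intro t ht
    rcases eq_or_lt_of_le (show 0 ≤ t from ht) with rfl | ht0
    · have h0 : assocTrace M (Real.log 0) = 0 := h.assocTrace_of_nonpos (by simp)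
      have he : (fun t => assocTrace M (Real.log t)) =ᶠ[𝓝[Ici 0] 0] fun _ => 0 := by
        filter_upwards [self_mem_nhdsWithin, mem_nhdsWithin_of_mem_nhds
          (Iio_mem_nhds (zero_lt_one' ℝ))] with s hs hs1
        exact h.assocTrace_of_nonpos (Real.log_nonpos hs (le_of_lt hs1))
      exact continuousWithinAt_const.congr_of_eventuallyEq he h0
    · exact (h.continuous_assocTrace.continuousAt.comp
        (Real.continuousAt_log ht0.ne')).continuousWithinAt
  monotoneOn := by
    intro s hs t ht hst
    rcases eq_or_lt_of_le (show 0 ≤ s from hs) with rfl | hs0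
    · simp only
      rw [h.assocTrace_of_nonpos (by simp : Real.log 0 ≤ 0)]
      exact h.assocTrace_nonneg _
    · exact h.assocTrace_mono (Real.log_le_log hs0 hst)
  map_zero := h.assocTrace_of_nonpos (by simp)
  log_isLittleO := by
    rw [Asymptotics.isLittleO_iff]
    intro c hc
    obtain ⟨C, hC⟩ := h.exists_le_assocTrace (2 / c)
    filter_upwards [Real.tendsto_log_atTop.eventually_ge_atTop (max 0 (c * C))] with t ht
    have ht0 : 0 ≤ Real.log t := (le_max_left _ _).trans ht
    rw [Real.norm_of_nonneg ht0, Real.norm_of_nonneg (h.assocTrace_nonneg _)]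
    have h1 := mul_le_mul_of_nonneg_left (hC _ ht0) hc.le
    have h2 : c * (2 / c * Real.log t) = 2 * Real.log t := by field_simp
    have h3 := (le_max_right 0 (c * C)).trans ht
    linarith
  convexOn := by
    simpa only [Real.log_exp] using h.convexOn_assocTrace
  doubling := by
    obtain ⟨C, hC⟩ := hd
    obtain ⟨B, hB⟩ := h.exists_le_assocTrace 1
    -- Once the trace is at least `1`, the additive constant `C` is absorbed into a second multiple
    -- of `|C|`.
    refine Asymptotics.IsBigO.of_bound (2 * |C|) ?_
    filter_upwards [Real.tendsto_log_atTop.eventually_ge_atTop (max 0 (1 + B)),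
      eventually_gt_atTop 0] with t ht ht0
    have hl0 : 0 ≤ Real.log t := (le_max_left _ _).trans ht
    have h1 := hB _ hl0
    have h2 := (le_max_right 0 (1 + B)).trans ht
    have h3 := hC _ hl0
    rw [Real.norm_of_nonneg (h.assocTrace_nonneg _), Real.norm_of_nonneg (h.assocTrace_nonneg _),
      Real.log_mul two_ne_zero ht0.ne', add_comm]
    have h4 : 1 ≤ assocTrace M (Real.log t) := by linarith
    nlinarith [le_abs_self C, abs_nonneg C]

/-- A `j`-th and a `k`-th term for `N` add up to at most the `(j + k)`-th term for `M` plus `log D`;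
the suprema over `j` and `k` are then taken independently. -/
theorem two_mul_assocTrace_le (hM : IsLC M) (hN : IsLC N) {D : ℝ} (hD : 0 < D)
    (h : ∀ j k, M (j + k) ≤ D * (N j * N k)) (y : ℝ) :
    2 * assocTrace N y ≤ assocTrace M y + Real.log D := by
  have key : ∀ j k : ℕ, ((j : ℝ) * y - Real.log (N j)) + ((k : ℝ) * y - Real.log (N k)) ≤
      assocTrace M y + Real.log D := by
    intro j k
    have h1 := Real.log_le_log (hM.pos _) (h j k)
    rw [Real.log_mul hD.ne' (mul_pos (hN.pos j) (hN.pos k)).ne',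
      Real.log_mul (hN.pos j).ne' (hN.pos k).ne'] at h1
    have h2 := hM.le_assocTrace (j + k) y
    push_cast at h2
    linarith
  have h1 : ∀ k : ℕ, assocTrace N y ≤
      assocTrace M y + Real.log D - ((k : ℝ) * y - Real.log (N k)) := fun k =>
    ciSup_le fun j => by linarith [key j k]
  have h2 : assocTrace N y ≤ assocTrace M y + Real.log D - assocTrace N y :=
    ciSup_le fun k => by linarith [h1 k]
  linarith

/-- The shift by `log 2` contributes `2 ^ j` to the `j`-th term, which the hypothesis absorbs. -/
theorem assocTrace_add_log_two_le (hM : IsLC M) (hN : IsLC N) {D : ℝ} (hD : 0 < D)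
    (h : ∀ j, 2 ^ j * M j ≤ D * N j) (y : ℝ) :
    assocTrace N (y + Real.log 2) ≤ assocTrace M y + Real.log D := by
  refine ciSup_le fun j => ?_
  have h1 := Real.log_le_log (mul_pos (by positivity) (hM.pos j)) (h j)
  rw [Real.log_mul (by positivity) (hM.pos j).ne', Real.log_mul hD.ne' (hN.pos j).ne',
    Real.log_pow] at h1
  have h2 := hM.le_assocTrace j y
  linarith

theorem assocTrace_le_of_powers (hM : IsLC M) (hN : IsLC N) {c : ℕ} (hc : 0 < c) {A : ℝ}
    (hA : 1 ≤ A) (h : ∀ j, N j ≤ A * M (c * j) ^ (1 / (c : ℝ))) :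
    ∃ C, ∀ y, 0 ≤ y → assocTrace M y ≤ ((c : ℝ) + 1) * assocTrace N y + C := by
  have hc' : (0 : ℝ) < c := by exact_mod_cast hc
  -- Write `k = c q + r` with `r < c`. Monotonicity and the hypothesis compare `log (M k)` with `c *
  -- log (N q)`, at the cost `c * log A`. The remainder `r y ≤ c y` is paid by the `c`-th term for
  -- `N`, whence the factor `c + 1` and the constant `log (N c)`.
  refine ⟨Real.log (N c) + c * Real.log A, fun y hy => ciSup_le fun k => ?_⟩
  have hk := Nat.div_add_mod k c
  set q := k / c
  have h1 : Real.log (M (c * q)) ≤ Real.log (M k) := hM.log_mono (by omega)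
  have h2 := Real.log_le_log (hN.pos q) (h q)
  rw [Real.log_mul (by positivity) (Real.rpow_pos_of_pos (hM.pos _) _).ne',
    Real.log_rpow (hM.pos _)] at h2
  have h3 := mul_le_mul_of_nonneg_left h2 hc'.le
  have h4 : (c : ℝ) * (Real.log A + 1 / c * Real.log (M (c * q))) =
      c * Real.log A + Real.log (M (c * q)) := by field_simp
  have h5 := mul_le_mul_of_nonneg_left (hN.le_assocTrace q y) hc'.le
  have h6 := hN.le_assocTrace c y
  have h7 : (k : ℝ) ≤ c * q + c := by
    have := (Nat.mod_lt k hc).le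
    exact_mod_cast (by omega : k ≤ c * q + c)
  have h8 := mul_le_mul_of_nonneg_right h7 hy
  nlinarith

theorem dominated_weights_of_assocTrace_le (h : IsLC N) (ω : WeightFunction) (s : PosReal)
    {C : ℝ} (hC : ∀ y, 0 ≤ y → assocTrace N y ≤ 1 / (s : ℝ) * ω.toFun (Real.exp y) + C) :
    Dominated (ω.weights s) N := by
  have hs : (0 : ℝ) < s := s.2
  refine ⟨Real.exp C, Real.exp_pos C, fun j => ?_⟩
  rw [← Real.exp_log (h.pos j), ← Real.exp_add]
  refine Real.exp_le_exp.2 ?_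
  rw [one_div_mul_eq_div, div_le_iff₀ hs]
  refine ciSup_le fun y => ?_
  have h1 := mul_le_mul_of_nonneg_right (hC y y.2) hs.le
  have h2 : (1 / (s : ℝ) * ω.toFun (Real.exp y) + C) * s = ω.toFun (Real.exp y) + C * s := by
    field_simp
  have h3 := mul_le_mul_of_nonneg_right (h.le_assocTrace j y) hs.le
  nlinarith

/-- Conjugation reverses inequalities. Log-convexity enters here: `log (N j)` is attained at some `y
≥ 0`, which is then a test point for the Young conjugate. -/
theorem dominated_of_le_assocTrace (h : IsLC N) (ω : WeightFunction) (s : PosReal) {C : ℝ}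
    (hC : ∀ y, 0 ≤ y → 1 / (s : ℝ) * ω.toFun (Real.exp y) ≤ assocTrace N y + C) :
    Dominated N (ω.weights s) := by
  have hs : (0 : ℝ) < s := s.2
  refine ⟨Real.exp C, Real.exp_pos C, fun j => ?_⟩
  rw [← Real.exp_log (h.pos j), WeightFunction.weights, ← Real.exp_add]
  refine Real.exp_le_exp.2 ?_
  obtain ⟨y, hy, hj⟩ := h.exists_log_eq j
  have h1 : (s : ℝ) * j * y - ω.toFun (Real.exp y) ≤ ω.youngConj (s * j) :=
    le_ciSup (ω.bddAbove_youngConj (s * j)) ⟨y, hy⟩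
  have h2 := mul_le_mul_of_nonneg_left h1 (one_div_pos.2 hs).le
  have h3 : 1 / (s : ℝ) * (s * j * y - ω.toFun (Real.exp y)) =
      j * y - 1 / (s : ℝ) * ω.toFun (Real.exp y) := by field_simp
  have h4 := hC y hy
  linarith

end IsLC

/-! ### The relation `≼` as domination up to geometric factors -/

theorem SeqLE.exists_le {M N : ℕ → ℝ} (h : SeqLE M N) (hM : ∀ j, 0 < M j) (hN : ∀ j, 0 < N j)
    (h0 : M 0 = N 0) : ∃ C : ℝ, 0 < C ∧ ∀ j, M j ≤ C ^ j * N j := by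
  obtain ⟨C, hC⟩ := h
  refine ⟨max C 1, by positivity, fun j => ?_⟩
  rcases Nat.eq_zero_or_pos j with rfl | hj
  · simp [h0]
  · have hq : 0 < M j / N j := div_pos (hM j) (hN j)
    have h1 := (hC ⟨j, hj, rfl⟩).trans (le_max_left C 1)
    have h2 := pow_le_pow_left₀ (Real.rpow_nonneg hq.le _) h1 j
    rw [← Real.rpow_natCast ((M j / N j) ^ (1 / (j : ℝ))) j, ← Real.rpow_mul hq.le,
      one_div_mul_cancel (by exact_mod_cast hj.ne'), Real.rpow_one] at h2
    exact (div_le_iff₀ (hN j)).1 h2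

theorem seqLE_of_le {M N : ℕ → ℝ} (hM : ∀ j, 0 < M j) (hN : ∀ j, 0 < N j) {B C : ℝ}
    (hC : 0 < C) (h : ∀ j, M j ≤ B * (C ^ j * N j)) : SeqLE M N := by
  refine ⟨max B 1 * C, ?_⟩
  rintro _ ⟨j, hj, rfl⟩
  have hj0 : (j : ℝ) ≠ 0 := by exact_mod_cast (by omega : j ≠ 0)
  have hB : 0 < max B 1 := by positivity
  have h1 : M j / N j ≤ (max B 1 * C) ^ j := by
    rw [div_le_iff₀ (hN j), mul_pow, mul_assoc]
    refine (h j).trans (mul_le_mul_of_nonneg_right ?_ (mul_pos (pow_pos hC j) (hN j)).le)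
    -- The constant is hidden in the geometric factor: `B ≤ (max B 1) ^ j`, as `j ≥ 1`.
    exact (le_max_left B 1).trans (le_self_pow₀ (le_max_right B 1) (by omega))
  calc (M j / N j) ^ (1 / (j : ℝ)) ≤ ((max B 1 * C) ^ j) ^ (1 / (j : ℝ)) :=
        Real.rpow_le_rpow (div_pos (hM j) (hN j)).le h1 (by positivity)
    _ = max B 1 * C := by
        rw [← Real.rpow_natCast, ← Real.rpow_mul (by positivity), mul_one_div_cancel hj0,
          Real.rpow_one]

/-! ### Weight matrices and their weight functions -/

namespace WeightMatrix

variable {M N : WeightMatrix}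

theorem IsStandardLogConvex.exists_le (hM : M.IsStandardLogConvex)
    (hN : N.IsStandardLogConvex) {α β : PosReal} (h : SeqLE (M.seq α) (N.seq β)) :
    ∃ C : ℝ, 0 < C ∧ ∀ j, M.seq α j ≤ C ^ j * N.seq β j :=
  h.exists_le (M.pos α) (N.pos β) ((hM α).zero.trans (hN β).zero.symm)

theorem isLogConvex_weights (hM : M.IsStandardLogConvex) (p : PosReal × PosReal) :
    IsLogConvex (M.weights p) := by
  have hp : (0 : ℝ) < p.2 := p.2.2
  refine ⟨fun j => mul_pos (pow_pos hp j) (M.pos _ j), fun j => ?_⟩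
  have h1 := mul_le_mul_of_nonneg_left ((hM p.1).logConvex j) (pow_pos hp (2 * j + 2)).le
  simp only [weights]
  calc ((p.2 : ℝ) ^ (j + 1) * M.seq p.1 (j + 1)) ^ 2
      = (p.2 : ℝ) ^ (2 * j + 2) * M.seq p.1 (j + 1) ^ 2 := by ring
    _ ≤ _ := h1
    _ = _ := by ring

theorem dominated_pow_weights (hM : M.IsStandardLogConvex) (p : PosReal × PosReal) (t : ℝ) :
    Dominated (fun j => t ^ j) (M.weights p) := by
  have hp : (0 : ℝ) < p.2 := p.2.2
  obtain ⟨C, hC, h⟩ := (hM p.1).dominated_pow (t / p.2)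
  refine ⟨C, hC, fun j => ?_⟩
  have h1 := mul_le_mul_of_nonneg_left (h j) (pow_pos hp j).le
  calc t ^ j = (p.2 : ℝ) ^ j * (t / p.2) ^ j := by rw [← mul_pow, mul_div_cancel₀ _ hp.ne']
    _ ≤ _ := h1
    _ = _ := by simp only [weights]; ring

theorem CondPowers.assocTrace_le (hN : N.IsStandardLogConvex) (h : N.CondPowers)
    (α β : PosReal) : ∃ c : ℝ, 0 < c ∧ ∃ C, ∀ y, 0 ≤ y →
      assocTrace (N.seq β) y ≤ c * assocTrace (N.seq α) y + C := by
  obtain ⟨c, hc, A, hA, hle⟩ := h α β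
  exact ⟨(c : ℝ) + 1, by positivity, (hN β).assocTrace_le_of_powers (hN α) hc hA hle⟩

/-- Condition (L) absorbs `C ^ j` and `C ^ k` separately, so only a constant remains and
`two_mul_assocTrace_le` applies. -/
theorem CondRmg.exists_le (hL : N.CondRL) (h : N.CondRmg) (α : PosReal) :
    ∃ D : ℝ, 0 < D ∧ ∃ γ, ∀ j k, N.seq α (j + k) ≤ D * (N.seq γ j * N.seq γ k) := by
  obtain ⟨C, hC, β, hβ⟩ := h α
  obtain ⟨D, hD, γ, hγ⟩ := hL C hC β
  refine ⟨C * (D * D), by positivity, γ, fun j k => (hβ j k).trans ?_⟩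
  have h1 := mul_le_mul (hγ j) (hγ k) (mul_pos (pow_pos hC k) (N.pos β k)).le
    (mul_pos hD (N.pos γ j)).le
  calc C ^ (j + k + 1) * N.seq β j * N.seq β k
      = C * (C ^ j * N.seq β j * (C ^ k * N.seq β k)) := by ring
    _ ≤ C * (D * N.seq γ j * (D * N.seq γ k)) := mul_le_mul_of_nonneg_left h1 hC.le
    _ = _ := by ring

theorem CondBmg.exists_le (hL : N.CondBL) (h : N.CondBmg) (α : PosReal) :
    ∃ D : ℝ, 0 < D ∧ ∃ γ, ∀ j k, N.seq γ (j + k) ≤ D * (N.seq α j * N.seq α k) := by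
  obtain ⟨C, hC, β, hβ⟩ := h α
  obtain ⟨D, hD, γ, hγ⟩ := hL C hC β
  refine ⟨D * C, by positivity, γ, fun j k => ?_⟩
  have h1 := (hγ (j + k)).trans (mul_le_mul_of_nonneg_left (hβ j k) hD.le)
  have hCp : 0 < C ^ (j + k) := by positivity
  refine le_of_mul_le_mul_left (h1.trans (le_of_eq ?_)) hCp
  ring

/-- Each use of moderate growth doubles the factor and moves to a new index of the matrix. -/
theorem exists_pow_mul_assocTrace_le_roumieu (hN : N.IsStandardLogConvex) (hL : N.CondRL)
    (h : N.CondRmg) (α : PosReal) (n : ℕ) :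
    ∃ γ C, ∀ y, 2 ^ n * assocTrace (N.seq γ) y ≤ assocTrace (N.seq α) y + C := by
  induction n with
  | zero => exact ⟨α, 0, fun y => by simp⟩
  | succ n ih =>
    obtain ⟨γ, C, hC⟩ := ih
    obtain ⟨D, hD, δ, hδ⟩ := h.exists_le hL γ
    refine ⟨δ, 2 ^ n * Real.log D + C, fun y => ?_⟩
    have h1 := mul_le_mul_of_nonneg_left ((hN γ).two_mul_assocTrace_le (hN δ) hD hδ y)
      (pow_nonneg (zero_le_two (α := ℝ)) n)
    have h2 := hC y
    rw [pow_succ]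
    linarith

theorem exists_pow_mul_assocTrace_le_beurling (hN : N.IsStandardLogConvex) (hL : N.CondBL)
    (h : N.CondBmg) (α : PosReal) (n : ℕ) :
    ∃ γ C, ∀ y, 2 ^ n * assocTrace (N.seq α) y ≤ assocTrace (N.seq γ) y + C := by
  induction n with
  | zero => exact ⟨α, 0, fun y => by simp⟩
  | succ n ih =>
    obtain ⟨γ, C, hC⟩ := ih
    obtain ⟨D, hD, δ, hδ⟩ := h.exists_le hL γ
    refine ⟨δ, 2 * C + Real.log D, fun y => ?_⟩
    have h1 := (hN δ).two_mul_assocTrace_le (hN γ) hD hδ y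
    have h2 := hC y
    rw [pow_succ]
    linarith

/-- Condition (L) with `C = 2` bounds the shifted trace of some other index `β` by the trace of `α`;
the condition on powers leads back from `β` to `α`, at the price of a factor. In the Beurling case
the two steps occur in the opposite order. -/
theorem CondRL.doubling (hN : N.IsStandardLogConvex) (hL : N.CondRL) (hP : N.CondPowers)
    (α : PosReal) : ∃ C, ∀ y, 0 ≤ y →
      assocTrace (N.seq α) (y + Real.log 2) ≤ C * assocTrace (N.seq α) y + C := by
  obtain ⟨D, hD, β, hβ⟩ := hL 2 two_pos α
  obtain ⟨c, hc, B, hB⟩ := hP.assocTrace_le hN β α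
  refine ⟨max c (c * Real.log D + B), fun y hy => ?_⟩
  have h1 := mul_le_mul_of_nonneg_left ((hN α).assocTrace_add_log_two_le (hN β) hD hβ y) hc.le
  have h2 := hB (y + Real.log 2) (add_nonneg hy (Real.log_nonneg one_le_two))
  have h3 := mul_le_mul_of_nonneg_right (le_max_left c (c * Real.log D + B))
    ((hN α).assocTrace_nonneg y)
  have h4 := le_max_right c (c * Real.log D + B)
  linarith

theorem CondBL.doubling (hN : N.IsStandardLogConvex) (hL : N.CondBL) (hP : N.CondPowers)
    (α : PosReal) : ∃ C, ∀ y, 0 ≤ y →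
      assocTrace (N.seq α) (y + Real.log 2) ≤ C * assocTrace (N.seq α) y + C := by
  obtain ⟨D, hD, β, hβ⟩ := hL 2 two_pos α
  obtain ⟨c, hc, B, hB⟩ := hP.assocTrace_le hN α β
  refine ⟨max c (B + Real.log D), fun y hy => ?_⟩
  have h1 := (hN β).assocTrace_add_log_two_le (hN α) hD hβ y
  have h2 := hB y hy
  have h3 := mul_le_mul_of_nonneg_right (le_max_left c (B + Real.log D))
    ((hN α).assocTrace_nonneg y)
  have h4 := le_max_right c (B + Real.log D)
  linarith

section AssocWeightFunction

variable {ω : WeightFunction} {α₀ : PosReal}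

theorem exists_dominated_weights (hN : N.IsStandardLogConvex) (hP : N.CondPowers)
    (hω : ∀ y, ω.toFun (Real.exp y) = assocTrace (N.seq α₀) y) (α : PosReal) :
    ∃ s, Dominated (N.seq α) (ω.weights s) := by
  obtain ⟨c, hc, C, hC⟩ := hP.assocTrace_le hN α α₀
  refine ⟨⟨c, hc⟩, (hN α).dominated_of_le_assocTrace ω ⟨c, hc⟩ (C := C / c) fun y hy => ?_⟩
  rw [hω, one_div_mul_eq_div, div_le_iff₀ hc, add_mul, div_mul_cancel₀ _ hc.ne']
  linarith [hC y hy]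

theorem exists_weights_dominated (hN : N.IsStandardLogConvex) (hP : N.CondPowers)
    (hω : ∀ y, ω.toFun (Real.exp y) = assocTrace (N.seq α₀) y) (α : PosReal) :
    ∃ s, Dominated (ω.weights s) (N.seq α) := by
  obtain ⟨c, hc, C, hC⟩ := hP.assocTrace_le hN α₀ α
  refine ⟨⟨1 / c, one_div_pos.2 hc⟩,
    (hN α).dominated_weights_of_assocTrace_le ω ⟨1 / c, one_div_pos.2 hc⟩ (C := C) fun y hy => ?_⟩
  rw [hω, one_div_one_div]
  exact hC y hy

/-- Unlike the two preceding facts, this concerns a prescribed `s`, possibly large. The condition on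
powers gives no control of its constant, so the iterated doubling is needed to exceed `s`. -/
theorem exists_weights_dominated_roumieu (hN : N.IsStandardLogConvex) (hL : N.CondRL)
    (h : N.CondRmg) (hω : ∀ y, ω.toFun (Real.exp y) = assocTrace (N.seq α₀) y) (s : PosReal) :
    ∃ α, Dominated (ω.weights s) (N.seq α) := by
  have hs : (0 : ℝ) < s := s.2
  obtain ⟨n, hn⟩ := pow_unbounded_of_one_lt (s : ℝ) one_lt_two
  obtain ⟨γ, C, hC⟩ := exists_pow_mul_assocTrace_le_roumieu hN hL h α₀ n
  refine ⟨γ, (hN γ).dominated_weights_of_assocTrace_le ω s (C := C / s) fun y _ => ?_⟩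
  have h1 := mul_le_mul_of_nonneg_right hn.le ((hN γ).assocTrace_nonneg y)
  rw [hω, one_div_mul_eq_div, ← add_div, le_div_iff₀ hs, mul_comm]
  exact h1.trans (hC y)

theorem exists_dominated_weights_beurling (hN : N.IsStandardLogConvex) (hL : N.CondBL)
    (h : N.CondBmg) (hω : ∀ y, ω.toFun (Real.exp y) = assocTrace (N.seq α₀) y) (s : PosReal) :
    ∃ α, Dominated (N.seq α) (ω.weights s) := by
  obtain ⟨n, hn⟩ := pow_unbounded_of_one_lt (1 / (s : ℝ)) one_lt_two
  obtain ⟨γ, C, hC⟩ := exists_pow_mul_assocTrace_le_beurling hN hL h α₀ n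
  refine ⟨γ, (hN γ).dominated_of_le_assocTrace ω s (C := C) fun y _ => ?_⟩
  rw [hω]
  exact (mul_le_mul_of_nonneg_right hn.le ((hN α₀).assocTrace_nonneg y)).trans (hC y)

end AssocWeightFunction

theorem exists_weightFunction_roumieu (hM : M.IsStandardLogConvex) (hN : N.IsStandardLogConvex)
    (hE : N.REquiv M) (hL : N.CondRL) (hmg : N.CondRmg) (hP : N.CondPowers) :
    ∃ ω : WeightFunction, ∀ (d : ℕ) (U : TopologicalSpace.Opens (Eucl d)),
      (M.roumieu U).Same (ω.roumieu U) := by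
  let α₀ : PosReal := ⟨1, mem_Ioi.2 one_pos⟩
  let ω := (hN α₀).weightFunction (hL.doubling hN hP α₀)
  have hω : ∀ y, ω.toFun (Real.exp y) = assocTrace (N.seq α₀) y := fun y =>
    congrArg (assocTrace (N.seq α₀)) (Real.log_exp y)
  refine ⟨ω, fun d U => roumieuSpace_same _ _ ?_ ?_ U⟩
  · rintro ⟨x, k⟩
    have hk : (0 : ℝ) < k := k.2
    obtain ⟨α, hα⟩ := hE.2 x
    obtain ⟨C, hC, hle⟩ := hM.exists_le hN hα
    -- Condition (L) removes at once the scale `k ^ j` of the weight and the factor `C ^ j` from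
    -- `≼`.
    obtain ⟨D, hD, β, hβ⟩ := hL (k * C) (mul_pos hk hC) α
    obtain ⟨s, hs⟩ := exists_dominated_weights hN hP hω β
    refine ⟨s, Dominated.trans ⟨D, hD, fun j => le_trans ?_ (hβ j)⟩ hs⟩
    rw [mul_pow, mul_assoc]
    exact mul_le_mul_of_nonneg_left (hle j) (pow_pos hk j).le
  · intro s
    obtain ⟨α, hα⟩ := exists_weights_dominated_roumieu hN hL hmg hω s
    obtain ⟨x, hx⟩ := hE.1 α
    obtain ⟨C, hC, hle⟩ := hN.exists_le hM hx
    exact ⟨(x, ⟨C, hC⟩), hα.trans ⟨1, one_pos, fun j => by rw [one_mul]; exact hle j⟩⟩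

theorem exists_weightFunction_beurling (hM : M.IsStandardLogConvex) (hN : N.IsStandardLogConvex)
    (hE : N.BEquiv M) (hL : N.CondBL) (hmg : N.CondBmg) (hP : N.CondPowers) :
    ∃ ω : WeightFunction, ∀ (d : ℕ) (U : TopologicalSpace.Opens (Eucl d)),
      (M.beurling U).Same (ω.beurling U) := by
  let α₀ : PosReal := ⟨1, mem_Ioi.2 one_pos⟩
  let ω := (hN α₀).weightFunction (hL.doubling hN hP α₀)
  have hω : ∀ y, ω.toFun (Real.exp y) = assocTrace (N.seq α₀) y := fun y =>
    congrArg (assocTrace (N.seq α₀)) (Real.log_exp y)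
  refine ⟨ω, fun d U => beurlingSpace_same ?_ ?_ U⟩
  · intro s
    obtain ⟨α, hα⟩ := exists_dominated_weights_beurling hN hL hmg hω s
    obtain ⟨x, hx⟩ := hE.2 α
    obtain ⟨C, hC, hle⟩ := hM.exists_le hN hx
    refine ⟨(x, ⟨1 / C, one_div_pos.2 hC⟩), Dominated.trans ⟨1, one_pos, fun j => ?_⟩ hα⟩
    have h1 := mul_le_mul_of_nonneg_left (hle j) (pow_pos (one_div_pos.2 hC) j).le
    rwa [← mul_assoc, ← mul_pow, one_div_mul_cancel hC.ne', one_pow] at h1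
  · rintro ⟨x, k⟩
    have hk : (0 : ℝ) < k := k.2
    obtain ⟨α, hα⟩ := hE.1 x
    obtain ⟨C, hC, hle⟩ := hN.exists_le hM hα
    obtain ⟨D, hD, β, hβ⟩ := hL (C / k) (div_pos hC hk) α
    obtain ⟨s, hs⟩ := exists_weights_dominated hN hP hω β
    refine ⟨s, hs.trans ⟨D, hD, fun j => ?_⟩⟩
    have h1 := (hβ j).trans (mul_le_mul_of_nonneg_left (hle j) hD.le)
    refine le_of_mul_le_mul_left (h1.trans (le_of_eq ?_)) (pow_pos (div_pos hC hk) j)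
    simp only [weights, div_pow]
    have := (pow_pos hk j).ne'
    field_simp

end WeightMatrix

/-! ### The weight matrix of a weight function -/

namespace WeightFunction

variable (ω : WeightFunction)

theorem le_youngConj (x : ℝ) {y : ℝ} (hy : 0 ≤ y) :
    x * y - ω.toFun (Real.exp y) ≤ ω.youngConj x :=
  le_ciSup (ω.bddAbove_youngConj x) ⟨y, hy⟩

theorem youngConj_le {x C : ℝ} (h : ∀ y, 0 ≤ y → x * y - ω.toFun (Real.exp y) ≤ C) :
    ω.youngConj x ≤ C :=
  ciSup_le fun y => h y y.2

theorem toFun_one_le {y : ℝ} (hy : 0 ≤ y) : ω.toFun 1 ≤ ω.toFun (Real.exp y) :=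
  ω.monotoneOn (mem_Ici.2 zero_le_one) (Real.exp_pos y).le (Real.one_le_exp hy)

/-- The Young conjugate of `y ↦ ω(e^y) - ω(1)`. -/
noncomputable def normConj (x : ℝ) : ℝ := ω.youngConj x + ω.toFun 1

theorem le_normConj (x : ℝ) {y : ℝ} (hy : 0 ≤ y) :
    x * y - (ω.toFun (Real.exp y) - ω.toFun 1) ≤ ω.normConj x := by
  have := ω.le_youngConj x hy
  rw [normConj]
  linarith

theorem normConj_le {x C : ℝ}
    (h : ∀ y, 0 ≤ y → x * y - (ω.toFun (Real.exp y) - ω.toFun 1) ≤ C) : ω.normConj x ≤ C := by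
  have := ω.youngConj_le (x := x) (C := C - ω.toFun 1) fun y hy => by linarith [h y hy]
  rw [normConj]
  linarith

theorem normConj_nonneg (x : ℝ) : 0 ≤ ω.normConj x := by
  have := ω.le_normConj x le_rfl
  simpa using this

theorem normConj_zero : ω.normConj 0 = 0 :=
  le_antisymm (ω.normConj_le fun y hy => by have := ω.toFun_one_le hy; linarith)
    (ω.normConj_nonneg 0)

/-- Midpoint convexity of a supremum of affine functions. This form yields both log-convexity and
moderate growth of the matrix. -/
theorem two_mul_normConj_add_le (a b : ℝ) :
    2 * ω.normConj (a + b) ≤ ω.normConj (2 * a) + ω.normConj (2 * b) := by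
  have : ω.normConj (a + b) ≤ (ω.normConj (2 * a) + ω.normConj (2 * b)) / 2 :=
    ω.normConj_le fun y hy => by
      have h1 := ω.le_normConj (2 * a) hy
      have h2 := ω.le_normConj (2 * b) hy
      linarith
  linarith

/-- The scaled conjugate is `sup_y (j y - (ω(e^y) - ω(1)) / s)`, and the subtracted function is
nonnegative, so larger `s` subtracts less. -/
theorem normConj_div_mono {s t : ℝ} (hs : 0 < s) (hst : s ≤ t) (j : ℝ) :
    1 / s * ω.normConj (s * j) ≤ 1 / t * ω.normConj (t * j) := by
  have ht := hs.trans_le hst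
  rw [one_div_mul_eq_div, one_div_mul_eq_div, div_le_iff₀ hs]
  refine ω.normConj_le fun y hy => ?_
  have h1 := mul_le_mul_of_nonneg_right (ω.le_normConj (t * j) hy) hs.le
  have h2 := mul_le_mul_of_nonneg_right hst (sub_nonneg.2 (ω.toFun_one_le hy))
  rw [div_mul_eq_mul_div, le_div_iff₀ ht]
  linarith

/-- The weight matrix `{exp ((1/h) φ*(h j)) : h > 0}` of `ω`, normalized at `j = 0`. -/
noncomputable def matrix : WeightMatrix where
  seq h j := Real.exp (1 / (h : ℝ) * ω.normConj (h * j))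
  pos _ _ := Real.exp_pos _
  mono h _ hhk _ := Real.exp_le_exp.2 (ω.normConj_div_mono h.2 hhk _)

theorem matrix_seq (h : PosReal) (j : ℕ) :
    ω.matrix.seq h j = Real.exp (1 / (h : ℝ) * ω.normConj (h * j)) := rfl

theorem matrix_seq_eq (h : PosReal) (j : ℕ) :
    ω.matrix.seq h j = Real.exp (1 / (h : ℝ) * ω.toFun 1) * ω.weights h j := by
  rw [matrix_seq, weights, ← Real.exp_add, normConj]
  ring_nf

theorem dominated_matrix_weights (h : PosReal) : Dominated (ω.matrix.seq h) (ω.weights h) :=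
  ⟨_, Real.exp_pos _, fun j => (ω.matrix_seq_eq h j).le⟩

theorem dominated_weights_matrix (h : PosReal) : Dominated (ω.weights h) (ω.matrix.seq h) := by
  refine ⟨(Real.exp (1 / (h : ℝ) * ω.toFun 1))⁻¹, inv_pos.2 (Real.exp_pos _), fun j => ?_⟩
  rw [matrix_seq_eq, inv_mul_cancel_left₀ (Real.exp_pos _).ne']

theorem matrix_isStandardLogConvex : ω.matrix.IsStandardLogConvex := by
  intro h
  have hh : (0 : ℝ) < h := h.2
  refine ⟨ω.matrix.pos h, ?_, ?_, fun j => ?_, ?_⟩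
  · simp [matrix_seq, normConj_zero]
  · exact Real.one_le_exp (mul_nonneg (one_div_pos.2 hh).le (ω.normConj_nonneg _))
  · rw [matrix_seq, matrix_seq, matrix_seq, ← Real.exp_nat_mul, ← Real.exp_add]
    refine Real.exp_le_exp.2 ?_
    have h1 := ω.two_mul_normConj_add_le (h * j / 2) (h * (j + 2 : ℕ) / 2)
    have e1 : (h * j / 2 + h * (j + 2 : ℕ) / 2 : ℝ) = h * (j + 1 : ℕ) := by push_cast; ring
    rw [e1, mul_div_cancel₀ _ two_ne_zero, mul_div_cancel₀ _ two_ne_zero] at h1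
    have h2 := mul_le_mul_of_nonneg_left h1 (one_div_pos.2 hh).le
    push_cast at h2 ⊢
    linarith
  · refine tendsto_atTop.2 fun b => ?_
    -- Testing the conjugate at `y` and dividing by `h j` loses at most `1` once `j` exceeds `n`,
    -- which the added `1` compensates.
    set y := Real.log (max b 1) + 1 with hy
    have hb : 0 < max b 1 := by positivity
    have hy0 : 0 ≤ y := add_nonneg (Real.log_nonneg (le_max_right b 1)) zero_le_one
    obtain ⟨n, hn⟩ := exists_nat_ge ((ω.toFun (Real.exp y) - ω.toFun 1) / h)
    filter_upwards [eventually_ge_atTop (n + 1)] with j hj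
    have hj0 : (0 : ℝ) < j := by exact_mod_cast (by omega : 0 < j)
    rw [matrix_seq, ← Real.exp_mul]
    have h1 := ω.le_normConj (h * j) hy0
    have h2 : (ω.toFun (Real.exp y) - ω.toFun 1) / h ≤ j :=
      hn.trans (by exact_mod_cast (by omega : n ≤ j))
    rw [div_le_iff₀ hh] at h2
    have h3 : Real.log (max b 1) ≤ 1 / (h : ℝ) * ω.normConj (h * j) * (1 / j) := by
      rw [one_div_mul_eq_div, mul_one_div, div_div, le_div_iff₀ (mul_pos hh hj0)]
      rw [hy] at h1
      linarith
    calc b ≤ max b 1 := le_max_left b 1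
      _ = Real.exp (Real.log (max b 1)) := (Real.exp_log hb).symm
      _ ≤ _ := Real.exp_le_exp.2 h3

/-- Taking the `c`-th root at index `c j` is exactly the change of parameter from `β` to `c β`, so
any `c ≥ α / β` works with `A = 1`. -/
theorem matrix_condPowers : ω.matrix.CondPowers := by
  intro α β
  have hα : (0 : ℝ) < α := α.2
  have hβ : (0 : ℝ) < β := β.2
  obtain ⟨c, hc⟩ := exists_nat_ge ((α : ℝ) / β)
  have hc0 : (0 : ℝ) < c := (div_pos hα hβ).trans_le hc
  rw [div_le_iff₀ hβ] at hc
  refine ⟨c, by exact_mod_cast hc0, 1, le_rfl, fun j => ?_⟩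
  rw [one_mul, matrix_seq, matrix_seq, ← Real.exp_mul]
  refine Real.exp_le_exp.2 ((ω.normConj_div_mono hα hc j).trans (le_of_eq ?_))
  push_cast
  rw [show (c * β * j : ℝ) = β * (c * j) by ring]
  field_simp

theorem matrix_seq_add_le {α β : PosReal} (h : (β : ℝ) = 2 * α) (j k : ℕ) :
    ω.matrix.seq α (j + k) ≤ 1 ^ (j + k + 1) * ω.matrix.seq β j * ω.matrix.seq β k := by
  have hα : (0 : ℝ) < α := α.2
  rw [one_pow, one_mul, matrix_seq, matrix_seq, matrix_seq, ← Real.exp_add, h]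
  refine Real.exp_le_exp.2 ?_
  have h1 := ω.two_mul_normConj_add_le (α * j) (α * k)
  have h2 := mul_le_mul_of_nonneg_left h1 (one_div_pos.2 (mul_pos two_pos hα)).le
  push_cast
  rw [mul_add (α : ℝ), mul_assoc 2 (α : ℝ), mul_assoc 2 (α : ℝ), ← mul_add (1 / (2 * (α : ℝ)))]
  refine le_trans (le_of_eq ?_) h2
  field_simp

theorem matrix_condRmg : ω.matrix.CondRmg := fun α =>
  ⟨1, one_pos, ⟨2 * α, mem_Ioi.2 (mul_pos two_pos α.2)⟩, ω.matrix_seq_add_le rfl⟩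

theorem matrix_condBmg : ω.matrix.CondBmg := fun α =>
  ⟨1, one_pos, ⟨α / 2, mem_Ioi.2 (half_pos α.2)⟩, ω.matrix_seq_add_le (mul_div_cancel₀ _ two_ne_zero).symm⟩

/-- The asymptotic bound holds only for large arguments; the additive `L` covers the rest by
monotonicity. -/
theorem exists_doubling : ∃ L : ℝ, 1 ≤ L ∧ ∀ y, 0 ≤ y →
    ω.toFun (Real.exp (y + Real.log 2)) ≤ L * ω.toFun (Real.exp y) + L := by
  obtain ⟨C, hC⟩ := ω.doubling.bound
  obtain ⟨T, hT⟩ := eventually_atTop.1 hC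
  have hT0 : 0 ≤ 2 * max T 1 := by positivity
  refine ⟨max 1 (max C (ω.toFun (2 * max T 1))), le_max_left _ _, fun y hy => ?_⟩
  have hL0 : 0 ≤ max 1 (max C (ω.toFun (2 * max T 1))) := zero_le_one.trans (le_max_left _ _)
  have hw := ω.nonneg (Real.exp y) (Real.exp_pos y).le
  rw [Real.exp_add, Real.exp_log two_pos, mul_comm]
  rcases le_total T (Real.exp y) with h | h
  · have h1 := hT _ h
    rw [Real.norm_of_nonneg hw, Real.norm_of_nonneg (ω.nonneg _ (by positivity))] at h1
    have h2 := mul_le_mul_of_nonneg_right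
      ((le_max_left C (ω.toFun (2 * max T 1))).trans (le_max_right 1 _)) hw
    linarith
  · have h1 : ω.toFun (2 * Real.exp y) ≤ ω.toFun (2 * max T 1) :=
      ω.monotoneOn (by simp [(Real.exp_pos y).le]) hT0
        (mul_le_mul_of_nonneg_left (h.trans (le_max_left _ _)) zero_le_two)
    have h2 := (le_max_right C (ω.toFun (2 * max T 1))).trans (le_max_right 1 _)
    have h3 := mul_nonneg hL0 hw
    linarith

theorem exists_le_shift (n : ℕ) : ∃ L : ℝ, 1 ≤ L ∧ ∀ y, 0 ≤ y →
    ω.toFun (Real.exp (y + n * Real.log 2)) ≤ L * ω.toFun (Real.exp y) + L := by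
  induction n with
  | zero => exact ⟨1, le_rfl, fun y _ => by simp⟩
  | succ n ih =>
    obtain ⟨L, hL, h⟩ := ih
    obtain ⟨L', hL', h'⟩ := ω.exists_doubling
    refine ⟨L' * L + L', by nlinarith, fun y hy => ?_⟩
    have hn : 0 ≤ (n : ℝ) * Real.log 2 := mul_nonneg n.cast_nonneg (Real.log_nonneg one_le_two)
    have h1 := h' (y + n * Real.log 2) (add_nonneg hy hn)
    have h2 := mul_le_mul_of_nonneg_left (h y hy) (zero_le_one.trans hL')
    have hw := mul_nonneg (zero_le_one.trans hL') (ω.nonneg (Real.exp y) (Real.exp_pos y).le)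
    push_cast
    rw [add_mul, one_mul, ← add_assoc]
    nlinarith

/-- Shifting the test point by `n log 2` gains `j * n * log 2`, enough for `C ^ j`, and costs a
factor `L` on `ω`, which multiplying the parameter by `L` undoes. Since `L` does not depend on the
index, the same bound serves Roumieu (`α ↦ L α`) and Beurling (`α ↦ α / L`). -/
theorem exists_pow_mul_matrix_le (C : ℝ) (hC : 0 < C) : ∃ L : ℝ, 0 < L ∧
    ∀ α β : PosReal, (β : ℝ) = L * α →
      ∃ D : ℝ, 0 < D ∧ ∀ j, C ^ j * ω.matrix.seq α j ≤ D * ω.matrix.seq β j := by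
  obtain ⟨n, hn⟩ := pow_unbounded_of_one_lt C one_lt_two
  obtain ⟨L, hL, h⟩ := ω.exists_le_shift n
  have hL0 : 0 < L := zero_lt_one.trans_le hL
  have hlog : Real.log C ≤ n * Real.log 2 := by
    rw [← Real.log_pow]
    exact Real.log_le_log hC hn.le
  have hn0 : 0 ≤ (n : ℝ) * Real.log 2 := mul_nonneg n.cast_nonneg (Real.log_nonneg one_le_two)
  refine ⟨L, hL0, fun α β hβ => ⟨Real.exp (1 / α * (ω.toFun 1 + 1)), Real.exp_pos _, fun j => ?_⟩⟩
  have hα : (0 : ℝ) < α := α.2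
  rw [matrix_seq, matrix_seq, ← Real.exp_log (pow_pos hC j), ← Real.exp_add, ← Real.exp_add,
    Real.log_pow, hβ]
  refine Real.exp_le_exp.2 ?_
  have key : ω.normConj (α * j) ≤
      ω.toFun 1 + 1 + 1 / L * ω.normConj (L * α * j) - α * (j * (n * Real.log 2)) := by
    refine ω.normConj_le fun y hy => ?_
    have h1 := ω.le_normConj (L * α * j) (add_nonneg hy hn0)
    have h2 := mul_le_mul_of_nonneg_left h1 (one_div_pos.2 hL0).le
    have h3 := mul_le_mul_of_nonneg_left (h y hy) (one_div_pos.2 hL0).le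
    have e1 : 1 / L * (L * ω.toFun (Real.exp y) + L) = ω.toFun (Real.exp y) + 1 := by field_simp
    have e2 : 1 / L * (L * α * j * (y + n * Real.log 2) -
        (ω.toFun (Real.exp (y + n * Real.log 2)) - ω.toFun 1)) =
        α * j * (y + n * Real.log 2) - 1 / L * ω.toFun (Real.exp (y + n * Real.log 2)) +
          1 / L * ω.toFun 1 := by field_simp; ring
    have h4 := mul_nonneg (one_div_pos.2 hL0).le (ω.nonneg 1 zero_le_one)
    linarith
  have h1 := mul_le_mul_of_nonneg_left key (one_div_pos.2 hα).le
  have h2 := mul_le_mul_of_nonneg_left hlog (j.cast_nonneg (α := ℝ))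
  have e1 : 1 / (α : ℝ) * (ω.toFun 1 + 1 + 1 / L * ω.normConj (L * α * j) -
      α * (j * (n * Real.log 2))) = 1 / α * (ω.toFun 1 + 1) +
        1 / (L * α) * ω.normConj (L * α * j) - j * (n * Real.log 2) := by field_simp
  linarith

theorem matrix_condRL : ω.matrix.CondRL := by
  intro C hC α
  obtain ⟨L, hL, h⟩ := ω.exists_pow_mul_matrix_le C hC
  obtain ⟨D, hD, h'⟩ := h α ⟨L * α, mul_pos hL α.2⟩ rfl
  exact ⟨D, hD, _, h'⟩

theorem matrix_condBL : ω.matrix.CondBL := by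
  intro C hC α
  obtain ⟨L, hL, h⟩ := ω.exists_pow_mul_matrix_le C hC
  obtain ⟨D, hD, h'⟩ := h ⟨α / L, div_pos α.2 hL⟩ α (mul_div_cancel₀ _ hL.ne').symm
  exact ⟨D, hD, _, h'⟩

theorem isLogConvex_weights (h : PosReal) : IsLogConvex (ω.weights h) := by
  refine ⟨fun j => Real.exp_pos _, fun j => ?_⟩
  have h1 := (ω.matrix_isStandardLogConvex h).logConvex j
  simp only [matrix_seq_eq] at h1
  have he : 0 < Real.exp (1 / (h : ℝ) * ω.toFun 1) ^ 2 := pow_pos (Real.exp_pos _) 2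
  refine le_of_mul_le_mul_left ?_ he
  calc _ = _ := (mul_pow _ _ _).symm
    _ ≤ _ := h1
    _ = _ := by ring

theorem dominated_pow_weights (h : PosReal) (t : ℝ) :
    Dominated (fun j => t ^ j) (ω.weights h) :=
  ((ω.matrix_isStandardLogConvex h).dominated_pow t).trans (ω.dominated_matrix_weights h)

end WeightFunction

/-! ### From equality of spaces to equivalence of matrices -/

namespace WeightMatrix

variable {M : WeightMatrix} {d : ℕ} {U : TopologicalSpace.Opens (Eucl d)}

/-- Only the equality of the underlying sets is used, in both directions. -/
theorem rEquiv_of_same (hM : M.IsStandardLogConvex) (ω : WeightFunction) (hd : 0 < d)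
    (hU : (U : Set (Eucl d)).Nonempty) (h : (M.roumieu U).Same (ω.roumieu U)) :
    ω.matrix.REquiv M := by
  obtain ⟨he, -, -⟩ := h
  have hle : roumieuCarrier M.weights M.weights_directed U ≤
    roumieuCarrier ω.weights ω.weights_directed U := he.le
  have hge : roumieuCarrier ω.weights ω.weights_directed U ≤
    roumieuCarrier M.weights M.weights_directed U := he.ge
  have h2 : ∀ {v : ℕ → ℝ} {j : ℕ} {b : ℝ}, (1 / 2) ^ j * v j ≤ b → v j ≤ 2 ^ j * b := by
    intro v j b hb
    have := mul_le_mul_of_nonneg_left hb (pow_nonneg (zero_le_two (α := ℝ)) j)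
    rwa [← mul_assoc, ← mul_pow, mul_one_div_cancel two_ne_zero, one_pow, one_mul] at this
  constructor
  · intro α
    obtain ⟨⟨x, k⟩, C, hC, hb⟩ := dominated_of_roumieuCarrier_le hd hU
      (fun k j => (isLogConvex_weights hM k).pos j) hge
      (ω.matrix_isStandardLogConvex α).isLogConvex (ω.dominated_matrix_weights α)
    have hk : (0 : ℝ) < k := k.2
    refine ⟨x, seqLE_of_le (ω.matrix.pos α) (M.pos x) (B := C) (mul_pos two_pos hk)
      fun j => (h2 (hb j)).trans (le_of_eq ?_)⟩
    simp only [weights]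
    ring
  · intro α
    obtain ⟨s, hs⟩ := dominated_of_roumieuCarrier_le hd hU
      (fun k j => (ω.isLogConvex_weights k).pos j) hle
      (hM α).isLogConvex (i := (α, ⟨1, mem_Ioi.2 one_pos⟩)) ⟨1, one_pos, fun j => by simp [weights]⟩
    obtain ⟨C, hC, hb⟩ := hs.trans (ω.dominated_weights_matrix s)
    exact ⟨s, seqLE_of_le (M.pos α) (ω.matrix.pos s) (B := C) two_pos
      fun j => (h2 (hb j)).trans (le_of_eq (by ring))⟩

/-- Here the topologies matter: each of the two continuous inclusions gives one of the two
comparisons. -/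
theorem bEquiv_of_same (hM : M.IsStandardLogConvex) (ω : WeightFunction) (hd : 0 < d)
    (hU : (U : Set (Eucl d)).Nonempty) (h : (M.beurling U).Same (ω.beurling U)) :
    ω.matrix.BEquiv M := by
  obtain ⟨he, hc, hc'⟩ := h
  constructor
  · intro α
    obtain ⟨s, hs⟩ := dominated_of_continuous_beurling ω.weights_mono ω.isLogConvex_weights
      ω.dominated_pow_weights hd hU (fun k j => (isLogConvex_weights hM k).pos j) he.ge hc'
      (α, ⟨1, mem_Ioi.2 one_pos⟩)
    obtain ⟨C, hC, hb⟩ := (ω.dominated_matrix_weights s).trans hs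
    exact ⟨s, seqLE_of_le (ω.matrix.pos s) (M.pos α) (B := C) one_pos hb⟩
  · intro α
    obtain ⟨⟨x, k⟩, hp⟩ := dominated_of_continuous_beurling M.weights_mono
      (isLogConvex_weights hM) (dominated_pow_weights hM) hd hU
      (fun k j => (ω.isLogConvex_weights k).pos j) he.le hc α
    have hk : (0 : ℝ) < k := k.2
    obtain ⟨C, hC, hb⟩ := hp.trans (ω.dominated_weights_matrix α)
    refine ⟨x, seqLE_of_le (M.pos x) (ω.matrix.pos α) (B := C) (inv_pos.2 hk) fun j => ?_⟩
    have h1 := mul_le_mul_of_nonneg_left (hb j) (pow_pos (inv_pos.2 hk) j).le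
    simp only [weights] at h1
    rw [← mul_assoc, ← mul_pow, inv_mul_cancel₀ hk.ne', one_pow, one_mul] at h1
    exact h1.trans (le_of_eq (by ring))

end WeightMatrix

theorem mainTheorem8 (M : WeightMatrix) (hM : M.IsStandardLogConvex) :
    (((∃ ω : WeightFunction, ∀ (d : ℕ) (U : TopologicalSpace.Opens (Eucl d)),
          0 < d → (U : Set (Eucl d)).Nonempty → (M.roumieu U).Same (ω.roumieu U)) ↔
        ∃ N : WeightMatrix, N.IsStandardLogConvex ∧ N.REquiv M ∧
          N.CondRL ∧ N.CondRmg ∧ N.CondPowers) ∧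
      ∀ (d : ℕ) (U : TopologicalSpace.Opens (Eucl d)), 0 < d → (U : Set (Eucl d)).Nonempty →
        ((∃ ω : WeightFunction, (M.roumieu U).Same (ω.roumieu U)) ↔
          ∃ N : WeightMatrix, N.IsStandardLogConvex ∧ N.REquiv M ∧
            N.CondRL ∧ N.CondRmg ∧ N.CondPowers)) ∧
    (((∃ ω : WeightFunction, ∀ (d : ℕ) (U : TopologicalSpace.Opens (Eucl d)),
          0 < d → (U : Set (Eucl d)).Nonempty → (M.beurling U).Same (ω.beurling U)) ↔
        ∃ N : WeightMatrix, N.IsStandardLogConvex ∧ N.BEquiv M ∧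
          N.CondBL ∧ N.CondBmg ∧ N.CondPowers) ∧
      ∀ (d : ℕ) (U : TopologicalSpace.Opens (Eucl d)), 0 < d → (U : Set (Eucl d)).Nonempty →
        ((∃ ω : WeightFunction, (M.beurling U).Same (ω.beurling U)) ↔
          ∃ N : WeightMatrix, N.IsStandardLogConvex ∧ N.BEquiv M ∧
            N.CondBL ∧ N.CondBmg ∧ N.CondPowers)) := by
  have hR : ∀ (d : ℕ) (U : TopologicalSpace.Opens (Eucl d)), 0 < d →
      (U : Set (Eucl d)).Nonempty → (∃ ω : WeightFunction, (M.roumieu U).Same (ω.roumieu U)) →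
      ∃ N : WeightMatrix, N.IsStandardLogConvex ∧ N.REquiv M ∧
        N.CondRL ∧ N.CondRmg ∧ N.CondPowers := by
    rintro d U hd hU ⟨ω, h⟩
    exact ⟨ω.matrix, ω.matrix_isStandardLogConvex, WeightMatrix.rEquiv_of_same hM ω hd hU h,
      ω.matrix_condRL, ω.matrix_condRmg, ω.matrix_condPowers⟩
  have hB : ∀ (d : ℕ) (U : TopologicalSpace.Opens (Eucl d)), 0 < d →
      (U : Set (Eucl d)).Nonempty → (∃ ω : WeightFunction, (M.beurling U).Same (ω.beurling U)) →
      ∃ N : WeightMatrix, N.IsStandardLogConvex ∧ N.BEquiv M ∧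
        N.CondBL ∧ N.CondBmg ∧ N.CondPowers := by
    rintro d U hd hU ⟨ω, h⟩
    exact ⟨ω.matrix, ω.matrix_isStandardLogConvex, WeightMatrix.bEquiv_of_same hM ω hd hU h,
      ω.matrix_condBL, ω.matrix_condBmg, ω.matrix_condPowers⟩
  -- A single pair, `d = 1` and `U = ℝ`, extracts the matrix condition from the assertion for all
  -- open sets.
  have hne : ((⊤ : TopologicalSpace.Opens (Eucl 1)) : Set (Eucl 1)).Nonempty := ⟨0, trivial⟩
  refine ⟨⟨⟨?_, ?_⟩, fun d U hd hU => ⟨hR d U hd hU, ?_⟩⟩,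
    ⟨⟨?_, ?_⟩, fun d U hd hU => ⟨hB d U hd hU, ?_⟩⟩⟩
  · rintro ⟨ω, h⟩
    exact hR 1 ⊤ one_pos hne ⟨ω, h 1 ⊤ one_pos hne⟩
  · rintro ⟨N, hN, hE, hL, hmg, hP⟩
    obtain ⟨ω, h⟩ := WeightMatrix.exists_weightFunction_roumieu hM hN hE hL hmg hP
    exact ⟨ω, fun d U _ _ => h d U⟩
  · rintro ⟨N, hN, hE, hL, hmg, hP⟩
    obtain ⟨ω, h⟩ := WeightMatrix.exists_weightFunction_roumieu hM hN hE hL hmg hP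
    exact ⟨ω, h d U⟩
  · rintro ⟨ω, h⟩
    exact hB 1 ⊤ one_pos hne ⟨ω, h 1 ⊤ one_pos hne⟩
  · rintro ⟨N, hN, hE, hL, hmg, hP⟩
    obtain ⟨ω, h⟩ := WeightMatrix.exists_weightFunction_beurling hM hN hE hL hmg hP
    exact ⟨ω, fun d U _ _ => h d U⟩
  · rintro ⟨N, hN, hE, hL, hmg, hP⟩
    obtain ⟨ω, h⟩ := WeightMatrix.exists_weightFunction_beurling hM hN hE hL hmg hP
    exact ⟨ω, h d U⟩
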